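/- Let $n\ge 0$ be an integer and let $\alpha,\beta\ge 0$ be real numbers with $\alpha+\beta+n>0$. Let $$\Omega_n(\alpha,\beta)=\{u+iv:\ -\beta<v/\pi<\alpha+n\}\setminus\bigcup_{j=0}^{n}\{u+iv:\ v/\pi=j,\ u\le 0\},$$ and denote its infinite boundary points by $\infty_0=-\infty+iv$ $(n<v/\pi<n+\alpha)$, $\infty_j=-\infty+iv$ $(n-j<v/\pi<n-j+1)$ for $1\le j\le n$, $\infty_{n+1}=-\infty+iv$ $(-\beta<v/\pi<0)$ and $\infty_{n+2}=+\infty+iv$. If $\alpha=0$, let $\infty_0$ stand for the boundary point $n\pi i$; if $\beta=0$, let $\infty_{n+1}$ stand for the boundary point $0$. There is exactly one conformal mapping $w=w_n(\cdot\,;\alpha,\beta)$ of the upper half-plane $\mathbb C_+$ onto $\Omega_n(\alpha,\beta)$ with $w(0)=\infty_0$, $w(1)=\infty_{n+1}$, $w(\infty)=\infty_{n+2}$ (in the sense of limits from $\mathbb C_+$), and there is a real constant $C=C_n(\alpha,\beta)$ with $$w(z)=(\alpha+\beta+n)\ln z+C-\beta\pi i+O(1/z)\qquad(z\to\infty,\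 z\in\mathbb C_+).$$ Each $\infty_j$, $1\le j\le n$, has exactly one real preimage $\xi_j=w^{-1}(\infty_j)$ under the boundary correspondence, and $$e^{w(t)}=t^\alpha(1-t)^\beta e^{C}(t-\xi_1)\cdots(t-\xi_n)$$ for $t\in\mathbb C_+$ (principal branches of the powers) and for $t\in[0,1]$ (boundary values from $\mathbb C_+$; $w$ itself has a finite boundary value wherever the right-hand side is non-zero, and $e^{w(t)}=0$ elsewhere). The polynomial $\tilde{\mathcal J}_n(t)=(t-\xi_1)\cdots(t-\xi_n)$ is the unique polynomial of least deviation from zero on $[0,1]$ with respect to the weight $t^\alpha(1-t)^\beta$, i.e. the unique minimizer of $\|P\|=\sup_{0\le t\le 1}t^\alpha(1-t)^\beta|P(t)|$ among the monic polynomials $P$ of degree $n$ with complex coefficients. Moreover $\|\tilde{\mathcal J}_n\|=e^{-C}$, that is, $e^{w(t)}=t^\alpha(1-t)^\beta\,\tilde{\mathcal J}_n(t)/\|\tilde{\mathcal J}_n\|$ for $t\in[0,1]$. -/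

import Mathlib

open Filter Topology

/-- The open upper half-plane, as a subset of `ℂ`. -/
def upperHalf : Set ℂ := {z | 0 < z.im}

/-- The comb-like domain: the horizontal strip `-β < v/π < α + n` without the `n + 1`
half-lines `v/π = j`, `u ≤ 0`, `j = 0, …, n` (where `w = u + iv`). -/
def combDomain (n : ℕ) (α β : ℝ) : Set ℂ :=
  {w | -β < w.im / Real.pi ∧ w.im / Real.pi < α + n} \
    ⋃ j ∈ Finset.range (n + 1), {w : ℂ | w.im / Real.pi = j ∧ w.re ≤ 0}

/-- The neighbourhood filter of the left infinite point `-∞ + iv`, `a < v/π < b`. -/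
def leftEnd (a b : ℝ) : Filter ℂ :=
  comap Complex.re atBot ⊓ 𝓟 {w | a < w.im / Real.pi ∧ w.im / Real.pi < b}

/-- The infinite boundary points `∞_j`, `1 ≤ j ≤ n`, between two consecutive cuts. -/
def midEnd (n j : ℕ) : Filter ℂ :=
  leftEnd ((n : ℝ) - j) ((n : ℝ) - j + 1)

open Classical in
/-- The boundary point `∞_0`, i.e. `-∞ + iv` with `n < v/π < n + α`. For `α = 0` this strip
degenerates and the point is the endpoint `nπi` of the uppermost half-line. -/
noncomputable def topEnd (n : ℕ) (α : ℝ) : Filter ℂ :=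
  if α = 0 then 𝓝 ((n : ℂ) * Real.pi * Complex.I) else leftEnd n (n + α)

open Classical in
/-- The boundary point `∞_{n+1}`, i.e. `-∞ + iv` with `-β < v/π < 0`. For `β = 0` this strip
degenerates and the point is the endpoint `0` of the lowermost half-line. -/
noncomputable def bottomEnd (β : ℝ) : Filter ℂ :=
  if β = 0 then 𝓝 0 else leftEnd (-β) 0

/-- The boundary point `∞_{n+2}`, i.e. `+∞ + iv`. -/
def rightEnd : Filter ℂ := comap Complex.re atTop

/-- `z → ∞` inside the upper half-plane. -/
noncomputable def atInftyUpper : Filter ℂ := Bornology.cobounded ℂ ⊓ 𝓟 upperHalf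

/-- `w` is a conformal mapping of the upper half-plane onto the comb domain with
`w(0) = ∞_0`, `w(1) = ∞_{n+1}`, `w(∞) = ∞_{n+2}`. (Only the values of `w` on the upper
half-plane matter.) -/
structure IsCombMap (n : ℕ) (α β : ℝ) (w : ℂ → ℂ) : Prop where
  differentiableOn : DifferentiableOn ℂ w upperHalf
  bijOn : Set.BijOn w upperHalf (combDomain n α β)
  at_zero : Tendsto w (𝓝[upperHalf] 0) (topEnd n α)
  at_one : Tendsto w (𝓝[upperHalf] 1) (bottomEnd β)
  at_infty : Tendsto w atInftyUpper rightEnd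

/-- The weighted uniform norm of a polynomial on `[0, 1]` for the weight `t^α (1 - t)^β`. -/
noncomputable def jacobiNorm (α β : ℝ) (p : Polynomial ℂ) : ℝ :=
  ⨆ t : Set.Icc (0 : ℝ) 1, (t : ℝ) ^ α * (1 - (t : ℝ)) ^ β * ‖p.eval ((t : ℝ) : ℂ)‖

/-- `p` is a polynomial of least deviation from zero on `[0, 1]` for the weight
`t^α (1 - t)^β`: it has minimal norm among all monic polynomials of degree `n` (with complex
coefficients). -/
def IsLeastDeviation (n : ℕ) (α β : ℝ) (p : Polynomial ℂ) : Prop :=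
  (p.Monic ∧ p.natDegree = n) ∧
    ∀ q : Polynomial ℂ, q.Monic → q.natDegree = n → jacobiNorm α β p ≤ jacobiNorm α β q

/-- The monic polynomial `(t - ξ_1) ⋯ (t - ξ_n)`. -/
noncomputable def monicJacobi (n : ℕ) (ξ : ℕ → ℝ) : Polynomial ℂ :=
  ∏ j ∈ Finset.Icc 1 n, (Polynomial.X - Polynomial.C (ξ j : ℂ))

/-! The map is constructed from the extremal polynomial, so neither the Riemann mapping theorem nor
Carathéodory's boundary theory is needed.

The extremal polynomial. Some real monic `p` of degree `n` minimises the weighted norm, because the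
distance to a finite-dimensional subspace is attained. By Kolmogorov's criterion, for every `q` of
degree less than `n` there is a point of maximal deviation where `p q ≤ 0`. If `p = s q`, this says
that `s` is negative at such a point. Suitable choices of `s` show that the zeros `ξ 1 < ... < ξ n`
of `p` are simple and lie in `(0, 1)`, and that the maximum `M` is attained between any two
consecutive points of `0, ξ 1, ..., ξ n, 1` (`exists_isEquioscillating`). Equioscillation makes `p`
the only minimiser, even among complex polynomials (`eq_of_norm_le`).

The conformal map. `combMap` is the logarithm of `t ^ α (1 - t) ^ β p(t) / M`, written as a sum of
logarithms with nonnegative weights. Its derivative has negative imaginary part, so it is injective.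
On the real axis its imaginary part is a step function, and on each interval between nodes its real
part is at most `0` and reaches `0`: the boundary values trace exactly the slits and the edges of
the strip. Hence the image fills the comb by connectedness, and avoids the slits by injectivity
(`combMap_bijOn`).

Uniqueness. Composing any normalised map with the inverse of `combMap` gives an automorphism of the
half-plane that fixes `0`, `1`, `∞`. Equality in Schwarz–Pick shows that it is the identity
(`eqOn_combMap`), and all assertions about `w` can be read off `combMap`. -/

/-! ### Best uniform approximation -/

/-- Kolmogorov's criterion for a function of least uniform norm on a compact space. -/
theorem ContinuousMap.exists_abs_eq_norm_of_norm_le_norm_sub_smul {X : Type*} [TopologicalSpace X]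
    [CompactSpace X] [FirstCountableTopology X] [Nonempty X] (f g : C(X, ℝ))
    (h : ∀ c : ℝ, ‖f‖ ≤ ‖f - c • g‖) : ∃ t, |f t| = ‖f‖ ∧ f t * g t ≤ 0 := by
  have key : ∀ k : ℕ, ∃ t, ‖f‖ ≤ |f t - (1 / ((k : ℝ) + 1)) * g t| := by
    intro k
    obtain ⟨t, -, ht⟩ := isCompact_univ.exists_isMaxOn (Set.univ_nonempty (α := X))
      ((f - (1 / ((k : ℝ) + 1)) • g).continuous.norm.continuousOn)
    refine ⟨t, (h (1 / ((k : ℝ) + 1))).trans ?_⟩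
    rw [ContinuousMap.norm_le _ (abs_nonneg _)]
    intro x
    simpa using ht (Set.mem_univ x)
  choose t ht using key
  obtain ⟨x, -, φ, hφ, hx⟩ := isCompact_univ.isSeqCompact (x := t) (fun n => Set.mem_univ _)
  have hε : Tendsto (fun k : ℕ => 1 / (((φ k : ℕ) : ℝ) + 1)) atTop (𝓝 0) :=
    tendsto_one_div_add_atTop_nhds_zero_nat.comp hφ.tendsto_atTop
  have hf : Tendsto (fun k => f (t (φ k))) atTop (𝓝 (f x)) := (f.continuous.tendsto x).comp hx
  have hg : Tendsto (fun k => g (t (φ k))) atTop (𝓝 (g x)) := (g.continuous.tendsto x).comp hx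
  refine ⟨x, le_antisymm (f.norm_coe_le_norm x) ?_, ?_⟩
  · have := (hf.sub (hε.mul hg)).abs
    rw [zero_mul, sub_zero] at this
    exact ge_of_tendsto' this fun k => ht (φ k)
  -- Squaring `|f| ≤ ‖f‖ ≤ |f - ε g|` at the maximum points and dividing by `ε` gives `2 f g - ε g ^
  -- 2 ≤ 0`; then `ε → 0`.
  · have h2 : Tendsto (fun k => 2 * (f (t (φ k)) * g (t (φ k)))
        - 1 / (((φ k : ℕ) : ℝ) + 1) * g (t (φ k)) ^ 2) atTop (𝓝 (2 * (f x * g x) - 0 * g x ^ 2)) :=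
      ((hf.mul hg).const_mul 2).sub (hε.mul (hg.pow 2))
    have h3 := le_of_tendsto' (b := 0) h2 fun k => by
      have h4 := ht (φ k)
      have h5 : |f (t (φ k))| ≤ ‖f‖ := f.norm_coe_le_norm _
      have h6 := sq_le_sq.2 (h5.trans h4)
      have h7 : (0 : ℝ) < 1 / (((φ k : ℕ) : ℝ) + 1) := by positivity
      set ε := 1 / (((φ k : ℕ) : ℝ) + 1)
      by_contra! hc
      nlinarith [mul_pos h7 hc]
    linarith

/-- A finite-dimensional subspace is proper and the distance to `x` tends to infinity along it, so
the minimum exists. -/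
theorem Submodule.exists_norm_sub_le {E : Type*} [NormedAddCommGroup E] [NormedSpace ℝ E]
    (S : Submodule ℝ E) [FiniteDimensional ℝ S] (x : E) : ∃ s : S, ∀ y : S, ‖x - s‖ ≤ ‖x - y‖ := by
  have : ProperSpace S := FiniteDimensional.proper_real S
  refine Continuous.exists_forall_le (f := fun s : S => ‖x - s‖) (by fun_prop) ?_
  refine tendsto_atTop_mono (fun s => ?_)
    (tendsto_atTop_add_const_right _ (-‖x‖) (tendsto_norm_cocompact_atTop (E := S)))
  have := norm_sub_norm_le (s : E) x
  rw [norm_sub_rev] at this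
  simpa [sub_eq_add_neg] using this

/-! ### Existence of an extremal polynomial -/

namespace WeightedChebyshev

open Polynomial

/-- The function `W * p` on `[0, 1]`. -/
noncomputable def weighted {W : ℝ → ℝ} (hW : Continuous W) (p : ℝ[X]) : C(Set.Icc (0 : ℝ) 1, ℝ) :=
  ⟨fun t => W t * p.eval (t : ℝ), by fun_prop⟩

/-- `q ↦ W * q` on polynomials of degree less than `n`. -/
noncomputable def weightedLinear {W : ℝ → ℝ} (hW : Continuous W) (n : ℕ) :
    degreeLT ℝ n →ₗ[ℝ] C(Set.Icc (0 : ℝ) 1, ℝ) where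
  toFun q := weighted hW q
  map_add' p q := by ext t; simp [weighted, mul_add]
  map_smul' c q := by ext t; simp [weighted]; ring

/-- The polynomial is `X ^ n - q₀`, with `W q₀` a best approximation to `W X ^ n`. Minimality under
the perturbations `c • q` is the hypothesis of Kolmogorov's criterion, and `W ≠ 0` at a point of
maximal deviation, so the weight cancels from the sign condition. -/
theorem exists_extremal {W : ℝ → ℝ} (hW : Continuous W) (hpos : ∀ t ∈ Set.Ioo (0 : ℝ) 1, 0 < W t)
    (h0 : ∀ t ∈ Set.Icc (0 : ℝ) 1, 0 ≤ W t) (n : ℕ) :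
    ∃ (p : ℝ[X]) (M : ℝ), p.Monic ∧ p.natDegree = n ∧ 0 < M ∧
      (∀ t ∈ Set.Icc (0 : ℝ) 1, W t * |p.eval t| ≤ M) ∧
      ∀ q : ℝ[X], q.degree < n →
        ∃ t ∈ Set.Icc (0 : ℝ) 1, W t * |p.eval t| = M ∧ p.eval t * q.eval t ≤ 0 := by
  have : FiniteDimensional ℝ (degreeLT ℝ n) := by
    exact (degreeLTEquiv ℝ n).symm.finiteDimensional
  obtain ⟨⟨_, q₀, rfl⟩, hs⟩ := (LinearMap.range (weightedLinear hW n)).exists_norm_sub_le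
    (weighted hW (X ^ n))
  have hq₀ : (q₀ : ℝ[X]).degree < n := mem_degreeLT.1 q₀.2
  set p : ℝ[X] := X ^ n - (q₀ : ℝ[X]) with hp
  have hmonic : p.Monic := monic_X_pow_sub hq₀
  have hdeg : p.natDegree = n := natDegree_eq_of_degree_eq_some <| by
    rw [hp, degree_sub_eq_left_of_degree_lt (by rwa [degree_X_pow]), degree_X_pow]
  have hval : ∀ t : Set.Icc (0 : ℝ) 1, |weighted hW p t| = W t * |p.eval (t : ℝ)| := by
    intro t
    simp [weighted, abs_mul, abs_of_nonneg (h0 t t.2)]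
  have hmin : ∀ q : degreeLT ℝ n, ‖weighted hW p‖ ≤ ‖weighted hW p - weighted hW q‖ := by
    intro q
    have h := hs ⟨_, q₀ + q, rfl⟩
    have e1 : weighted hW (X ^ n) - weightedLinear hW n q₀ = weighted hW p := by
      ext t; simp [weighted, weightedLinear, hp]; ring
    have e2 : weighted hW (X ^ n) - weightedLinear hW n (q₀ + q)
        = weighted hW p - weighted hW q := by
      ext t; simp [weighted, weightedLinear, hp]; ring
    rwa [e1, e2] at h
  have hM : 0 < ‖weighted hW p‖ := by
    rw [norm_pos_iff]
    intro h
    have hinf : (p.rootSet ℝ).Infinite := by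
      refine (Set.Ioo_infinite (zero_lt_one (α := ℝ))).mono fun t ht => ?_
      have h1 := DFunLike.congr_fun h ⟨t, Set.Ioo_subset_Icc_self ht⟩
      rw [mem_rootSet]
      refine ⟨hmonic.ne_zero, ?_⟩
      simpa [weighted, (hpos t ht).ne'] using h1
    exact hinf (rootSet_finite p ℝ)
  refine ⟨p, ‖weighted hW p‖, hmonic, hdeg, hM, ?_, ?_⟩
  · intro t ht
    rw [← hval ⟨t, ht⟩]
    exact (weighted hW p).norm_coe_le_norm ⟨t, ht⟩
  · intro q hq
    obtain ⟨t, ht1, ht2⟩ := (weighted hW p).exists_abs_eq_norm_of_norm_le_norm_sub_smul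
      (weighted hW q) fun c => by
        have := hmin (c • ⟨q, mem_degreeLT.2 hq⟩)
        convert this using 2
        ext t; simp [weighted]; ring
    rw [hval] at ht1
    by_cases hW0 : W t = 0
    · rw [hW0, zero_mul] at ht1
      exact absurd ht1 hM.ne
    · refine ⟨t, t.2, ht1, ?_⟩
      have hW1 : 0 < W t := lt_of_le_of_ne (h0 t t.2) (Ne.symm hW0)
      have h3 : W t * W t * (p.eval (t : ℝ) * q.eval (t : ℝ)) ≤ 0 := by
        have := ht2
        simp only [weighted, ContinuousMap.coe_mk] at this
        linarith
      by_contra! hc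
      nlinarith [mul_pos (mul_pos hW1 hW1) hc]

end WeightedChebyshev

/-! ### Zeros, equioscillation and rigidity -/

namespace WeightedChebyshev

open Polynomial

/-- At a point of maximal deviation `p ≠ 0`, so `0 ≥ p q = s q ^ 2` determines the sign of `s`. All
information on the zeros comes from choosing `s`. -/
theorem exists_factor_neg {W : ℝ → ℝ} {n : ℕ} {p : ℝ[X]} {M : ℝ} (hM : 0 < M)
    (hK : ∀ q : ℝ[X], q.degree < n →
      ∃ t ∈ Set.Icc (0 : ℝ) 1, W t * |p.eval t| = M ∧ p.eval t * q.eval t ≤ 0)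
    {s q : ℝ[X]} (hp : p = s * q) (hq : q.degree < n) :
    ∃ t ∈ Set.Icc (0 : ℝ) 1, W t * |p.eval t| = M ∧ s.eval t < 0 := by
  obtain ⟨t, ht, h1, h2⟩ := hK q hq
  refine ⟨t, ht, h1, ?_⟩
  have h3 : p.eval t ≠ 0 := by
    intro h
    simp only [h, abs_zero, mul_zero] at h1
    exact hM.ne h1
  rw [hp, eval_mul] at h2 h3
  have h4 : 0 < q.eval t ^ 2 := by
    have := right_ne_zero_of_mul h3
    positivity
  have h5 := left_ne_zero_of_mul h3
  by_contra! hc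
  have : 0 < s.eval t := lt_of_le_of_ne hc (Ne.symm h5)
  nlinarith [mul_pos this h4]

theorem exists_factor_pos {W : ℝ → ℝ} {n : ℕ} {p : ℝ[X]} {M : ℝ} (hM : 0 < M)
    (hK : ∀ q : ℝ[X], q.degree < n →
      ∃ t ∈ Set.Icc (0 : ℝ) 1, W t * |p.eval t| = M ∧ p.eval t * q.eval t ≤ 0)
    {s q : ℝ[X]} (hp : p = s * q) (hq : q.degree < n) :
    ∃ t ∈ Set.Icc (0 : ℝ) 1, W t * |p.eval t| = M ∧ 0 < s.eval t := by
  obtain ⟨t, ht, h1, h2⟩ := exists_factor_neg hM hK (s := -s) (q := -q) (by rw [hp]; ring)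
    (by rwa [degree_neg])
  exact ⟨t, ht, h1, by simpa using h2⟩

/-- Let `r` collect the distinct zeros in `(0, 1)`. If `deg r < n`, the cofactor `s` takes both
signs on `[0, 1]`, hence vanishes at some `a` in `(0, 1)`, which is then at least a double zero of
`p`. But the factor `(X - a) ^ 2` is never negative, contrary to the criterion. -/
theorem eq_prod_roots {W : ℝ → ℝ} {n : ℕ} {p : ℝ[X]} {M : ℝ} (hM : 0 < M)
    (hp : p.Monic) (hn : p.natDegree = n)
    (hK : ∀ q : ℝ[X], q.degree < n →
      ∃ t ∈ Set.Icc (0 : ℝ) 1, W t * |p.eval t| = M ∧ p.eval t * q.eval t ≤ 0) :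
    ∃ R : Finset ℝ, (∀ a ∈ R, a ∈ Set.Ioo (0 : ℝ) 1) ∧ p = ∏ a ∈ R, (X - C a) := by
  classical
  set R : Finset ℝ := p.roots.toFinset.filter (· ∈ Set.Ioo (0 : ℝ) 1) with hR
  set r : ℝ[X] := ∏ a ∈ R, (X - C a) with hr
  have hrm : r.Monic := monic_prod_of_monic _ _ fun a _ => monic_X_sub_C a
  have hdvd : r ∣ p := by
    have : R.val ≤ p.roots := by
      refine (Multiset.le_iff_subset R.nodup).2 fun a ha => ?_
      have : a ∈ R := ha
      rw [hR, Finset.mem_filter, Multiset.mem_toFinset] at this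
      exact this.1
    exact (Multiset.prod_X_sub_C_dvd_iff_le_roots hp.ne_zero _).2 this
  refine ⟨R, fun a ha => (Finset.mem_filter.1 ha).2, ?_⟩
  refine eq_of_monic_of_dvd_of_natDegree_le hrm hp hdvd ?_
  by_contra! hlt
  obtain ⟨s, hs⟩ := hdvd
  have hrd : r.degree < n := by
    rw [← hn]
    exact degree_lt_degree hlt |>.trans_le degree_le_natDegree
  have hps : p = s * r := by rw [hs, mul_comm]
  obtain ⟨t₁, ht₁, h1, h1'⟩ := exists_factor_neg hM hK hps hrd
  obtain ⟨t₂, ht₂, h2, h2'⟩ := exists_factor_pos hM hK hps hrd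
  obtain ⟨a, ha, ha0⟩ : ∃ a ∈ Set.uIcc t₁ t₂, s.eval a = 0 := by
    have := intermediate_value_uIcc (a := t₁) (b := t₂) (f := fun x => s.eval x)
      s.continuous.continuousOn
    exact this (Set.mem_uIcc.2 (Or.inl ⟨h1'.le, h2'.le⟩))
  have hat₁ : a ≠ t₁ := by rintro rfl; exact h1'.ne ha0
  have hat₂ : a ≠ t₂ := by rintro rfl; exact h2'.ne' ha0
  have ha01 : a ∈ Set.Ioo (0 : ℝ) 1 := by
    rw [Set.mem_uIcc] at ha
    rcases ha with ha | ha
    · exact ⟨ht₁.1.trans_lt (lt_of_le_of_ne ha.1 hat₁.symm),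
        (lt_of_le_of_ne ha.2 hat₂).trans_le ht₂.2⟩
    · exact ⟨ht₂.1.trans_lt (lt_of_le_of_ne ha.1 hat₂.symm),
        (lt_of_le_of_ne ha.2 hat₁).trans_le ht₁.2⟩
  have haR : a ∈ R := by
    rw [hR, Finset.mem_filter, Multiset.mem_toFinset, mem_roots hp.ne_zero]
    refine ⟨?_, ha01⟩
    rw [IsRoot, hps, eval_mul, ha0, zero_mul]
  obtain ⟨s', hs'⟩ := dvd_iff_isRoot.2 (show s.IsRoot a from ha0)
  have hrr : r = (X - C a) * ∏ b ∈ R.erase a, (X - C b) := (Finset.mul_prod_erase R _ haR).symm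
  have hpp : p = (X - C a) ^ 2 * ((∏ b ∈ R.erase a, (X - C b)) * s') := by
    rw [hps, hs', hrr]; ring
  have hne : (∏ b ∈ R.erase a, (X - C b)) * s' ≠ 0 := by
    intro h
    rw [h, mul_zero] at hpp
    exact hp.ne_zero hpp
  have hdeg : ((∏ b ∈ R.erase a, (X - C b)) * s').degree < n := by
    rw [degree_eq_natDegree hne]
    have := congrArg natDegree hpp
    rw [natDegree_mul (pow_ne_zero _ (X_sub_C_ne_zero a)) hne, natDegree_pow, natDegree_X_sub_C,
      hn] at this
    exact_mod_cast (by omega : _ < n)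
  obtain ⟨t, -, -, ht⟩ := exists_factor_neg hM hK hpp hdeg
  rw [eval_pow] at ht
  exact absurd ht (not_lt.2 (sq_nonneg _))

/-- `0 = ξ 0 < ξ 1 < ⋯ < ξ (n + 1) = 1` are such that `W |(t - ξ 1) ⋯ (t - ξ n)|` has the same
maximum `M > 0` on all the intervals `[ξ k, ξ (k + 1)]`. -/
structure IsEquioscillating (W : ℝ → ℝ) (n : ℕ) (ξ : ℕ → ℝ) (M : ℝ) : Prop where
  strictMono : StrictMono ξ
  zero : ξ 0 = 0
  last : ξ (n + 1) = 1
  pos : 0 < M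
  le : ∀ t ∈ Set.Icc (0 : ℝ) 1, W t * |∏ j ∈ Finset.Icc 1 n, (t - ξ j)| ≤ M
  exists_eq : ∀ k ≤ n, ∃ t ∈ Set.Icc (ξ k) (ξ (k + 1)),
    W t * |∏ j ∈ Finset.Icc 1 n, (t - ξ j)| = M

theorem exists_enumeration (R : Finset ℝ) (hR : ∀ a ∈ R, a ∈ Set.Ioo (0 : ℝ) 1) :
    ∃ ξ : ℕ → ℝ, StrictMono ξ ∧ ξ 0 = 0 ∧ ξ (R.card + 1) = 1 ∧
      ∏ j ∈ Finset.Icc 1 R.card, (X - C (ξ j)) = ∏ a ∈ R, (X - C a) := by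
  set e := R.orderIsoOfFin rfl with he
  -- Beyond the roots the value `j - R.card` is `1` at `R.card + 1`, and keeps `ξ` strictly
  -- increasing on all of `ℕ`.
  set ξ : ℕ → ℝ := fun j =>
    if j = 0 then 0 else if h : j - 1 < R.card then (e ⟨j - 1, h⟩ : ℝ) else (j : ℝ) - R.card with hξ
  have hsucc : ∀ i (h : i < R.card), ξ (1 + i) = e ⟨i, h⟩ := by
    intro i h
    simp [hξ, h]
  refine ⟨ξ, strictMono_nat_of_lt_succ fun j => ?_, by simp [hξ], by simp [hξ], ?_⟩
  · rcases Nat.eq_zero_or_pos j with rfl | hj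
    · by_cases h : 0 < R.card
      · have := hsucc 0 h
        rw [add_zero] at this
        rw [zero_add, this]
        simpa [hξ] using (hR _ (e ⟨0, h⟩).2).1
      · simp only [hξ, if_true]
        have h0 : R.card = 0 := by omega
        simp [h0]
    · obtain ⟨i, rfl⟩ : ∃ i, j = 1 + i := ⟨j - 1, by omega⟩
      by_cases h1 : i + 1 < R.card
      · have e1 := hsucc i (by omega)
        have e2 := hsucc (i + 1) h1
        rw [e1, add_assoc, e2]
        have : e ⟨i, by omega⟩ < e ⟨i + 1, h1⟩ := e.strictMono (by simp [Fin.lt_def])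
        exact_mod_cast this
      · by_cases h2 : i < R.card
        · rw [hsucc i h2]
          have : i + 1 = R.card := by omega
          have h3 : ξ (1 + i + 1) = 1 := by
            rw [show 1 + i + 1 = R.card + 1 by omega]; simp [hξ]
          rw [h3]
          exact (hR _ (e ⟨i, h2⟩).2).2
        · have h3 : ¬ (1 + i + 1 - 1 < R.card) := by omega
          have h4 : ¬ (1 + i - 1 < R.card) := by omega
          simp only [hξ, h3, h4, dif_neg, not_false_iff]
          rw [if_neg (by omega), if_neg (by omega)]
          push_cast
          linarith
  · rw [← Finset.Ico_add_one_right_eq_Icc, Finset.prod_Ico_eq_prod_range, Nat.add_sub_cancel,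
      Finset.prod_range, ← Finset.prod_coe_sort R]
    refine Fintype.prod_equiv e.toEquiv _ _ fun i => ?_
    rw [hsucc i i.2]
    rfl

/-- The interval is located by the sign of a factor: `X - ξ 1` negative for the first, `X - ξ n`
positive for the last, and `(X - ξ k) (X - ξ (k + 1))` negative for an inner one. -/
theorem exists_isEquioscillating {W : ℝ → ℝ} (hW : Continuous W)
    (hpos : ∀ t ∈ Set.Ioo (0 : ℝ) 1, 0 < W t)
    (h0 : ∀ t ∈ Set.Icc (0 : ℝ) 1, 0 ≤ W t) (n : ℕ) :
    ∃ (ξ : ℕ → ℝ) (M : ℝ), IsEquioscillating W n ξ M := by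
  obtain ⟨p, M, hp, hn, hM, hle, hK⟩ := exists_extremal hW hpos h0 n
  obtain ⟨R, hR, hpR⟩ := eq_prod_roots hM hp hn hK
  obtain ⟨ξ, hmono, hz, hl, hprod⟩ := exists_enumeration R hR
  have hcard : R.card = n := by
    rw [← hn, hpR, natDegree_prod_of_monic _ _ fun a _ => monic_X_sub_C a]
    simp
  rw [hcard] at hl hprod
  rw [← hprod] at hpR
  have heval : ∀ t, p.eval t = ∏ j ∈ Finset.Icc 1 n, (t - ξ j) := by
    intro t
    rw [hpR, eval_prod]
    simp
  have hfac : ∀ A ⊆ Finset.Icc 1 n, A.Nonempty →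
      p = (∏ j ∈ A, (X - C (ξ j))) * ∏ j ∈ Finset.Icc 1 n \ A, (X - C (ξ j)) ∧
      (∏ j ∈ Finset.Icc 1 n \ A, (X - C (ξ j))).degree < (n : WithBot ℕ) := by
    intro A hA hne
    refine ⟨by rw [hpR, mul_comm, Finset.prod_sdiff hA], ?_⟩
    rw [degree_prod]
    simp only [degree_X_sub_C, Finset.sum_const, nsmul_eq_mul, mul_one]
    have h1 := Finset.card_sdiff_add_card_eq_card hA
    have h2 := hne.card_pos
    rw [Nat.card_Icc] at h1
    exact_mod_cast (by omega : _ < n)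
  refine ⟨ξ, M, hmono, hz, hl, hM, fun t ht => by rw [← heval]; exact hle t ht, fun k hk => ?_⟩
  simp only [← heval]
  rcases Nat.eq_zero_or_pos n with rfl | hn0
  -- Without nodes there is no factor to remove; `q = 0` already supplies a point of maximal
  -- deviation.
  · obtain ⟨t, ht, h1, -⟩ := hK 0 (by simp)
    obtain rfl : k = 0 := by omega
    exact ⟨t, by rwa [hz, hl], h1⟩
  rcases Nat.eq_zero_or_pos k with rfl | hk0
  · obtain ⟨h1, h2⟩ := hfac {1} (by simp; omega) (by simp)
    obtain ⟨t, ht, h3, h4⟩ := exists_factor_neg hM hK h1 h2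
    simp only [Finset.prod_singleton, eval_sub, eval_X, eval_C] at h4
    exact ⟨t, ⟨by rw [hz]; exact ht.1, by rw [zero_add]; linarith⟩, h3⟩
  rcases eq_or_lt_of_le hk with rfl | hkn
  · obtain ⟨h1, h2⟩ := hfac {k} (by simp; omega) (by simp)
    obtain ⟨t, ht, h3, h4⟩ := exists_factor_pos hM hK h1 h2
    simp only [Finset.prod_singleton, eval_sub, eval_X, eval_C] at h4
    exact ⟨t, ⟨by linarith, by rw [hl]; exact ht.2⟩, h3⟩
  · obtain ⟨h1, h2⟩ := hfac {k, k + 1} (by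
      intro j hj
      simp only [Finset.mem_insert, Finset.mem_singleton] at hj
      rw [Finset.mem_Icc]; omega) (by simp)
    obtain ⟨t, ht, h3, h4⟩ := exists_factor_neg hM hK h1 h2
    rw [Finset.prod_pair (by omega)] at h4
    simp only [eval_mul, eval_sub, eval_X, eval_C] at h4
    have h5 : ξ k < ξ (k + 1) := hmono (Nat.lt_succ_self k)
    refine ⟨t, ⟨?_, ?_⟩, h3⟩
    · by_contra! hc
      nlinarith [mul_pos (sub_pos.2 hc) (sub_pos.2 (hc.trans h5))]
    · by_contra! hc
      nlinarith [mul_pos (sub_pos.2 hc) (sub_pos.2 (h5.trans hc))]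

/-- The coefficient of degree `n` of `P - Q` is zero, and by Lagrange's formula it is a sum over the
`n + 1` extremal points `t k`. There `d k` has the sign of `p (t k)` and `|Q| ≤ |p|`, so each
summand has nonnegative real part and hence real part zero. Thus `Re Q = p`, then `Im Q = 0`, and `P
- Q` has more zeros than its degree allows. -/
theorem IsEquioscillating.eq_of_norm_le {W : ℝ → ℝ} {n : ℕ} {ξ : ℕ → ℝ} {M : ℝ}
    (h : IsEquioscillating W n ξ M) (h0 : ∀ t ∈ Set.Icc (0 : ℝ) 1, 0 ≤ W t)
    {Q : ℂ[X]} (hQ : Q.Monic) (hn : Q.natDegree = n)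
    (hle : ∀ t ∈ Set.Icc (0 : ℝ) 1, W t * ‖Q.eval (t : ℂ)‖ ≤ M) :
    Q = ∏ j ∈ Finset.Icc 1 n, (X - C (ξ j : ℂ)) := by
  set P : ℂ[X] := ∏ j ∈ Finset.Icc 1 n, (X - C (ξ j : ℂ)) with hP
  have hPm : P.Monic := monic_prod_of_monic _ _ fun a _ => monic_X_sub_C _
  have hPn : P.natDegree = n := by
    rw [hP, natDegree_prod_of_monic _ _ fun a _ => monic_X_sub_C _]
    simp
  have hex := fun k : ℕ => fun hk : k ≤ n => h.exists_eq k hk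
  choose! t ht htM using hex
  set p : ℝ → ℝ := fun x => ∏ j ∈ Finset.Icc 1 n, (x - ξ j) with hp
  have hp0 : ∀ k ≤ n, p (t k) ≠ 0 := by
    intro k hk hc
    have h1 := htM k hk
    change W (t k) * |p (t k)| = M at h1
    rw [hc, abs_zero, mul_zero] at h1
    exact h.pos.ne h1
  have hξ : ∀ k ≤ n, ∀ j ∈ Finset.Icc 1 n, t k ≠ ξ j := fun k hk j hj hc =>
    hp0 k hk (Finset.prod_eq_zero hj (sub_eq_zero.2 hc))
  have hgt : ∀ k ≤ n, ∀ j ∈ Finset.Icc 1 n, j ≤ k → ξ j < t k := fun k hk j hj hjk =>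
    lt_of_le_of_ne ((h.strictMono.monotone hjk).trans (ht k hk).1) (hξ k hk j hj).symm
  have hlt : ∀ k ≤ n, ∀ j ∈ Finset.Icc 1 n, k < j → t k < ξ j := fun k hk j hj hjk =>
    lt_of_le_of_ne ((ht k hk).2.trans (h.strictMono.monotone hjk)) (hξ k hk j hj)
  have htlt : ∀ i k, i < k → k ≤ n → t i < t k := by
    intro i k hik hk
    have hm : i + 1 ∈ Finset.Icc 1 n := by rw [Finset.mem_Icc]; omega
    exact (hlt i (by omega) (i + 1) hm (by omega)).trans (hgt k hk (i + 1) hm (by omega))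
  have ht01 : ∀ k ≤ n, t k ∈ Set.Icc (0 : ℝ) 1 := by
    intro k hk
    constructor
    · rw [← h.zero]; exact (h.strictMono.monotone (Nat.zero_le k)).trans (ht k hk).1
    · rw [← h.last]; exact (ht k hk).2.trans (h.strictMono.monotone (by omega))
  have hWpos : ∀ k ≤ n, 0 < W (t k) := by
    intro k hk
    refine lt_of_le_of_ne (h0 _ (ht01 k hk)) fun hc => ?_
    have h1 := htM k hk
    rw [← hc, zero_mul] at h1
    exact h.pos.ne h1
  have hQle : ∀ k ≤ n, ‖Q.eval (t k : ℂ)‖ ≤ |p (t k)| := by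
    intro k hk
    have h1 := hle _ (ht01 k hk)
    rw [← htM k hk] at h1
    exact le_of_mul_le_mul_left h1 (hWpos k hk)
  set d : ℕ → ℝ := fun k => ∏ j ∈ (Finset.range (n + 1)).erase k, (t k - t j) with hd
  have hsign : ∀ k ≤ n, 0 < d k * p (t k) := by
    intro k hk
    -- Pair the other extremal points with the nodes: `t j` with `ξ (j + 1)` to the left of `t k`,
    -- with `ξ j` to the right. Both differences in a pair have the same sign.
    have hbij : p (t k) = ∏ j ∈ (Finset.range (n + 1)).erase k,
        (t k - ξ (if j < k then j + 1 else j)) := by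
      symm
      refine Finset.prod_bij (fun j _ => if j < k then j + 1 else j) ?_ ?_ ?_ ?_
      · intro j hj
        rw [Finset.mem_erase, Finset.mem_range] at hj
        rw [Finset.mem_Icc]
        split_ifs <;> omega
      · intro i hi j hj hij
        rw [Finset.mem_erase, Finset.mem_range] at hi hj
        split_ifs at hij <;> omega
      · intro j hj
        rw [Finset.mem_Icc] at hj
        by_cases hjk : j ≤ k
        · refine ⟨j - 1, ?_, ?_⟩
          · rw [Finset.mem_erase, Finset.mem_range]; omega
          · rw [if_pos (by omega)]; omega
        · refine ⟨j, ?_, ?_⟩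
          · rw [Finset.mem_erase, Finset.mem_range]; omega
          · rw [if_neg (by omega)]
      · intros; rfl
    rw [hbij, hd, ← Finset.prod_mul_distrib]
    refine Finset.prod_pos fun j hj => ?_
    rw [Finset.mem_erase, Finset.mem_range] at hj
    split_ifs with hjk
    · exact mul_pos (sub_pos.2 (htlt j k hjk hk))
        (sub_pos.2 (hgt k hk _ (by rw [Finset.mem_Icc]; omega) (by omega)))
    · exact mul_pos_of_neg_of_neg (sub_neg.2 (htlt k j (by omega) (by omega)))
        (sub_neg.2 (hlt k hk _ (by rw [Finset.mem_Icc]; omega) (by omega)))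
  have hPeval : ∀ x : ℝ, P.eval (x : ℂ) = (p x : ℂ) := by
    intro x
    rw [hP, eval_prod, hp]
    simp
  have hdegP : P.degree = n := by rw [degree_eq_natDegree hPm.ne_zero, hPn]
  have hdegQ : Q.degree = n := by rw [degree_eq_natDegree hQ.ne_zero, hn]
  have hinj : Set.InjOn (fun k => (t k : ℂ)) (Finset.range (n + 1) : Finset ℕ) := by
    intro i hi j hj hij
    have hij' : t i = t j := Complex.ofReal_injective hij
    simp only [Finset.coe_range, Set.mem_Iio] at hi hj
    rcases lt_trichotomy i j with hlt' | heq | hgt'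
    · exact absurd hij' (htlt i j hlt' (by omega)).ne
    · exact heq
    · exact absurd hij' (htlt j i hgt' (by omega)).ne'
  have hdegD : (P - Q).degree < (Finset.range (n + 1)).card := by
    rw [Finset.card_range]
    refine (degree_sub_le _ _).trans_lt ?_
    rw [hdegP, hdegQ, max_self]
    exact_mod_cast Nat.lt_succ_self n
  have hsum := Lagrange.coeff_eq_sum hinj hdegD
  rw [Finset.card_range, Nat.add_sub_cancel, coeff_sub] at hsum
  have hc1 : P.coeff n = 1 := by rw [← hPn]; exact hPm
  have hc2 : Q.coeff n = 1 := by rw [← hn]; exact hQ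
  rw [hc1, hc2, sub_self] at hsum
  have hre : ∀ k, ((P - Q).eval (t k : ℂ) /
      ∏ j ∈ (Finset.range (n + 1)).erase k, ((t k : ℂ) - (t j : ℂ))).re
      = (p (t k) - (Q.eval (t k : ℂ)).re) / d k := by
    intro k
    have : ∏ j ∈ (Finset.range (n + 1)).erase k, ((t k : ℂ) - (t j : ℂ)) = (d k : ℂ) := by
      rw [hd]; push_cast; rfl
    rw [this, eval_sub, hPeval, Complex.div_ofReal_re]
    simp
  have hsum' := congrArg Complex.re hsum
  rw [Complex.re_sum, Complex.zero_re] at hsum'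
  simp only [hre] at hsum'
  have hnn : ∀ k ∈ Finset.range (n + 1), 0 ≤ (p (t k) - (Q.eval (t k : ℂ)).re) / d k := by
    intro k hk
    have hk' : k ≤ n := by rw [Finset.mem_range] at hk; omega
    have h1 := hsign k hk'
    have h2 := (Complex.abs_re_le_norm _).trans (hQle k hk')
    rcases lt_or_gt_of_ne (hp0 k hk') with hneg | hpos
    · have h3 : d k < 0 := by
        by_contra! hc
        nlinarith [mul_nonneg hc (neg_nonneg.2 hneg.le)]
      rw [abs_of_neg hneg] at h2
      exact div_nonneg_of_nonpos (by linarith [(abs_le.1 h2).1]) h3.le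
    · have h3 : 0 < d k := by
        by_contra! hc
        nlinarith [mul_nonneg (neg_nonneg.2 hc) hpos.le]
      rw [abs_of_pos hpos] at h2
      exact div_nonneg (by linarith [(abs_le.1 h2).2]) h3.le
  have hzero := (Finset.sum_eq_zero_iff_of_nonneg hnn).1 hsum'.symm
  have hev : ∀ k ∈ Finset.range (n + 1), (P - Q).eval (t k : ℂ) = 0 := by
    intro k hk
    have hk' : k ≤ n := by rw [Finset.mem_range] at hk; omega
    have h1 := hzero k hk
    have h2 : d k ≠ 0 := left_ne_zero_of_mul (hsign k hk').ne'
    rw [div_eq_zero_iff, or_iff_left h2] at h1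
    have h3 := hQle k hk'
    have h4 : (Q.eval (t k : ℂ)).im = 0 := by
      have h5 := Complex.sq_norm (Q.eval (t k : ℂ))
      rw [Complex.normSq_apply] at h5
      have h6 := pow_le_pow_left₀ (norm_nonneg _) h3 2
      rw [sq_abs, h5] at h6
      have h7 : p (t k) = (Q.eval (t k : ℂ)).re := by linarith
      rw [h7] at h6
      nlinarith
    rw [eval_sub, hPeval, sub_eq_zero]
    refine Complex.ext ?_ ?_
    · rw [Complex.ofReal_re]; linarith
    · rw [Complex.ofReal_im, h4]
  have := eq_zero_of_degree_lt_of_eval_index_eq_zero _ hinj hdegD hev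
  exact (sub_eq_zero.1 this).symm

end WeightedChebyshev

/-! ### The Jacobi weight and its least-deviation polynomial -/

theorem jacobiWeight_continuous {α β : ℝ} (hα : 0 ≤ α) (hβ : 0 ≤ β) :
    Continuous fun t : ℝ => t ^ α * (1 - t) ^ β :=
  (Real.continuous_rpow_const hα).mul
    ((Real.continuous_rpow_const hβ).comp (continuous_const.sub continuous_id))

theorem jacobiWeight_nonneg (α β : ℝ) : ∀ t ∈ Set.Icc (0 : ℝ) 1, 0 ≤ t ^ α * (1 - t) ^ β :=
  fun _ ht => mul_nonneg (Real.rpow_nonneg ht.1 _) (Real.rpow_nonneg (sub_nonneg.2 ht.2) _)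

theorem jacobiWeight_pos (α β : ℝ) : ∀ t ∈ Set.Ioo (0 : ℝ) 1, 0 < t ^ α * (1 - t) ^ β :=
  fun _ ht => mul_pos (Real.rpow_pos_of_pos ht.1 _) (Real.rpow_pos_of_pos (sub_pos.2 ht.2) _)

theorem le_jacobiNorm {α β : ℝ} (hα : 0 ≤ α) (hβ : 0 ≤ β) (p : Polynomial ℂ) {t : ℝ}
    (ht : t ∈ Set.Icc (0 : ℝ) 1) : t ^ α * (1 - t) ^ β * ‖p.eval (t : ℂ)‖ ≤ jacobiNorm α β p := by
  have hc : Continuous fun t : Set.Icc (0 : ℝ) 1 =>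
      (t : ℝ) ^ α * (1 - (t : ℝ)) ^ β * ‖p.eval ((t : ℝ) : ℂ)‖ :=
    ((jacobiWeight_continuous hα hβ).comp continuous_subtype_val).mul
      (p.continuous.comp (Complex.continuous_ofReal.comp continuous_subtype_val)).norm
  exact le_ciSup (isCompact_range hc).bddAbove (⟨t, ht⟩ : Set.Icc (0 : ℝ) 1)

theorem monicJacobi_monic (n : ℕ) (ξ : ℕ → ℝ) : (monicJacobi n ξ).Monic :=
  Polynomial.monic_prod_of_monic _ _ fun _ _ => Polynomial.monic_X_sub_C _

theorem monicJacobi_natDegree (n : ℕ) (ξ : ℕ → ℝ) : (monicJacobi n ξ).natDegree = n := by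
  rw [monicJacobi, Polynomial.natDegree_prod_of_monic _ _ fun _ _ => Polynomial.monic_X_sub_C _]
  simp

theorem monicJacobi_eval (n : ℕ) (ξ : ℕ → ℝ) (t : ℝ) :
    (monicJacobi n ξ).eval (t : ℂ) = ((∏ j ∈ Finset.Icc 1 n, (t - ξ j) : ℝ) : ℂ) := by
  rw [monicJacobi, Polynomial.eval_prod]
  simp

namespace WeightedChebyshev.IsEquioscillating

variable {n : ℕ} {α β M : ℝ} {ξ : ℕ → ℝ}

theorem jacobiNorm_eq (h : IsEquioscillating (fun t => t ^ α * (1 - t) ^ β) n ξ M) (hα : 0 ≤ α)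
    (hβ : 0 ≤ β) : jacobiNorm α β (monicJacobi n ξ) = M := by
  apply le_antisymm
  · have : Nonempty (Set.Icc (0 : ℝ) 1) := ⟨⟨0, by simp⟩⟩
    refine ciSup_le fun t => ?_
    rw [monicJacobi_eval, Complex.norm_real]
    exact h.le t t.2
  · obtain ⟨t, ht, htM⟩ := h.exists_eq 0 (Nat.zero_le n)
    have ht01 : t ∈ Set.Icc (0 : ℝ) 1 := by
      refine ⟨by rw [← h.zero]; exact ht.1, ht.2.trans ?_⟩
      rw [← h.last]
      exact h.strictMono.monotone (by omega)
    have := le_jacobiNorm hα hβ (monicJacobi n ξ) ht01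
    rw [monicJacobi_eval, Complex.norm_real] at this
    exact htM.symm.le.trans this

/-- A competitor of norm at most `M` is the equioscillating polynomial itself; this rigidity gives
minimality and uniqueness together. -/
theorem isLeastDeviation_iff (h : IsEquioscillating (fun t => t ^ α * (1 - t) ^ β) n ξ M)
    (hα : 0 ≤ α) (hβ : 0 ≤ β) (p : Polynomial ℂ) :
    IsLeastDeviation n α β p ↔ p = monicJacobi n ξ := by
  have key : ∀ q : Polynomial ℂ, q.Monic → q.natDegree = n →
      jacobiNorm α β q ≤ jacobiNorm α β (monicJacobi n ξ) → q = monicJacobi n ξ := by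
    intro q hq hqn hle
    refine h.eq_of_norm_le (jacobiWeight_nonneg α β) hq hqn fun t ht => ?_
    rw [← h.jacobiNorm_eq hα hβ]
    exact (le_jacobiNorm hα hβ q ht).trans hle
  constructor
  · rintro ⟨⟨hp, hpn⟩, hmin⟩
    exact key p hp hpn (hmin _ (monicJacobi_monic n ξ) (monicJacobi_natDegree n ξ))
  · rintro rfl
    refine ⟨⟨monicJacobi_monic n ξ, monicJacobi_natDegree n ξ⟩, fun q hq hqn => ?_⟩
    rcases le_total (jacobiNorm α β (monicJacobi n ξ)) (jacobiNorm α β q) with hle | hle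
    · exact hle
    · rw [key q hq hqn hle]

end WeightedChebyshev.IsEquioscillating

/-! ### The half-plane, its ends, and a univalence criterion -/

theorem isOpen_upperHalf : IsOpen upperHalf := isOpen_lt continuous_const Complex.continuous_im

theorem convex_upperHalf : Convex ℝ upperHalf := convex_halfSpace_im_gt 0

theorem ofReal_mem_closure_upperHalf (x : ℝ) : (x : ℂ) ∈ closure upperHalf := by
  have h : closure upperHalf = {z : ℂ | 0 ≤ z.im} := Complex.closure_setOfPred_lt_im 0
  rw [h]
  simp

instance nhdsWithin_upperHalf_neBot (x : ℝ) : (𝓝[upperHalf] (x : ℂ)).NeBot :=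
  mem_closure_iff_nhdsWithin_neBot.1 (ofReal_mem_closure_upperHalf x)

instance atInftyUpper_neBot : atInftyUpper.NeBot := by
  have h : Tendsto (fun y : ℝ => (y : ℂ) * Complex.I) atTop atInftyUpper := by
    refine tendsto_inf.2 ⟨?_, ?_⟩
    · rw [← tendsto_norm_atTop_iff_cobounded]
      simpa using tendsto_abs_atTop_atTop
    · rw [tendsto_principal]
      filter_upwards [eventually_gt_atTop 0] with y hy
      simpa [upperHalf] using hy
  exact h.neBot

theorem tendsto_vertical (x : ℝ) :
    Tendsto (fun ε : ℝ => (x : ℂ) + ε * Complex.I) (𝓝[>] 0) (𝓝[upperHalf] (x : ℂ)) := by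
  refine tendsto_nhdsWithin_iff.2 ⟨?_, ?_⟩
  · have : Continuous fun ε : ℝ => (x : ℂ) + ε * Complex.I := by fun_prop
    have h := this.tendsto 0
    simp only [Complex.ofReal_zero, zero_mul, add_zero] at h
    exact h.mono_left nhdsWithin_le_nhds
  · filter_upwards [self_mem_nhdsWithin] with ε hε
    simpa [upperHalf] using hε

/-- The ends of the upper half-plane: its points, the points of the real line, and infinity. -/
theorem ultrafilter_upperHalf_cases (F : Ultrafilter ℂ) (hF : upperHalf ∈ F) :
    (∃ z ∈ upperHalf, (F : Filter ℂ) ≤ 𝓝 z) ∨ (∃ x : ℝ, (F : Filter ℂ) ≤ 𝓝[upperHalf] (x : ℂ)) ∨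
      (F : Filter ℂ) ≤ atInftyUpper := by
  by_cases hc : (F : Filter ℂ) ≤ Bornology.cobounded ℂ
  · exact Or.inr (Or.inr (le_inf hc (le_principal_iff.2 hF)))
  · obtain ⟨s, hs, hsF⟩ := Filter.not_le.1 hc
    have hb : Bornology.IsBounded sᶜ := Bornology.isBounded_compl_iff.2 hs
    obtain ⟨R, hR⟩ := hb.subset_closedBall 0
    have hmem : Metric.closedBall (0 : ℂ) R ∈ F :=
      mem_of_superset (Ultrafilter.compl_mem_iff_notMem.2 hsF) hR
    obtain ⟨z, -, hz⟩ := (isCompact_closedBall (0 : ℂ) R).ultrafilter_le_nhds' F hmem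
    have him : 0 ≤ z.im := by
      have : z ∈ closure upperHalf := mem_closure_iff_ultrafilter.2 ⟨F, hF, hz⟩
      rwa [show closure upperHalf = {z : ℂ | 0 ≤ z.im} from Complex.closure_setOfPred_lt_im 0] at this
    rcases him.lt_or_eq with h | h
    · exact Or.inl ⟨z, h, hz⟩
    · refine Or.inr (Or.inl ⟨z.re, ?_⟩)
      have : ((z.re : ℝ) : ℂ) = z := Complex.ext (by simp) (by simpa using h)
      rw [this]
      exact le_inf hz (le_principal_iff.2 hF)

/-- The Noshiro-Warschawski theorem, for a derivative with values in the lower half-plane. -/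
theorem injOn_of_im_deriv_neg {U : Set ℂ} (hU : Convex ℝ U) {f f' : ℂ → ℂ}
    (hf : ∀ z ∈ U, HasDerivAt f (f' z) z) (hneg : ∀ z ∈ U, (f' z).im < 0) : Set.InjOn f U := by
  intro a ha b hb hab
  by_contra hne
  have hd : b - a ≠ 0 := sub_ne_zero.2 (Ne.symm hne)
  set g : ℝ → ℂ := fun t => f (a + t * (b - a)) / (b - a) with hg
  have hmem : ∀ t ∈ Set.Icc (0 : ℝ) 1, a + t * (b - a) ∈ U := by
    intro t ht
    have := hU.add_smul_sub_mem ha hb ht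
    simpa using this
  have hder : ∀ t ∈ Set.Icc (0 : ℝ) 1, HasDerivAt (fun t => (g t).im)
      (f' (a + t * (b - a))).im t := by
    intro t ht
    have h1 : HasDerivAt (fun t : ℝ => a + (t : ℂ) * (b - a)) (1 * (b - a)) t :=
      ((Complex.ofRealCLM.hasDerivAt (x := t)).mul_const (b - a)).const_add a
    have h2 := ((hf _ (hmem t ht)).comp t h1).div_const (b - a)
    have h3 : f' (a + t * (b - a)) * (1 * (b - a)) / (b - a) = f' (a + t * (b - a)) := by
      field_simp
    rw [h3] at h2
    exact Complex.imCLM.hasFDerivAt.comp_hasDerivAt t h2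
  have hanti : StrictAntiOn (fun t => (g t).im) (Set.Icc (0 : ℝ) 1) := by
    refine strictAntiOn_of_deriv_neg (convex_Icc 0 1)
      (fun t ht => (hder t ht).continuousAt.continuousWithinAt) fun t ht => ?_
    rw [interior_Icc] at ht
    have ht' := Set.Ioo_subset_Icc_self ht
    rw [(hder t ht').deriv]
    exact hneg _ (hmem t ht')
  have := hanti (Set.left_mem_Icc.2 zero_le_one) (Set.right_mem_Icc.2 zero_le_one) zero_lt_one
  simp [hg, hab] at this

/-! ### Weighted sums of logarithms -/

/-- A weighted sum of logarithms with real singularities. -/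
noncomputable def logSum (s : Finset ℕ) (γ ξ : ℕ → ℝ) (z : ℂ) : ℂ :=
  ∑ j ∈ s, γ j * Complex.log (z - ξ j)

namespace logSum

variable {s : Finset ℕ} {γ ξ : ℕ → ℝ}

theorem sub_mem_upperHalf {z : ℂ} (hz : z ∈ upperHalf) (a : ℝ) : 0 < (z - a).im := by
  simpa [upperHalf] using hz

theorem hasDerivAt {z : ℂ} (hz : z ∈ upperHalf) :
    HasDerivAt (logSum s γ ξ) (∑ j ∈ s, γ j * (1 / (z - ξ j))) z := by
  refine HasDerivAt.fun_sum fun j _ => ?_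
  have h : z - ξ j ∈ Complex.slitPlane := Or.inr (sub_mem_upperHalf hz (ξ j)).ne'
  exact (((hasDerivAt_id z).sub_const _).clog h).const_mul _

/-- Each `1 / (z - ξ j)` lies in the lower half-plane, and some weight is positive. -/
theorem im_deriv_neg (hγ : ∀ j ∈ s, 0 ≤ γ j) (hΓ : 0 < ∑ j ∈ s, γ j) {z : ℂ}
    (hz : z ∈ upperHalf) : (∑ j ∈ s, (γ j : ℂ) * (1 / (z - ξ j))).im < 0 := by
  have him : ∀ j, (1 / (z - ξ j)).im < 0 := by
    intro j
    have h := sub_mem_upperHalf hz (ξ j)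
    rw [one_div, Complex.inv_im]
    refine div_neg_of_neg_of_pos (neg_lt_zero.2 h) (Complex.normSq_pos.2 fun hc => ?_)
    rw [hc] at h
    simp at h
  obtain ⟨i, hi, hi0⟩ : ∃ i ∈ s, γ i ≠ 0 := Finset.exists_ne_zero_of_sum_ne_zero hΓ.ne'
  rw [Complex.im_sum]
  refine Finset.sum_neg' (fun j hj => ?_) ⟨i, hi, ?_⟩
  · rw [Complex.im_ofReal_mul]
    exact mul_nonpos_of_nonneg_of_nonpos (hγ j hj) (him j).le
  · rw [Complex.im_ofReal_mul]
    exact mul_neg_of_pos_of_neg (lt_of_le_of_ne (hγ i hi) (Ne.symm hi0)) (him i)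

theorem injOn (hγ : ∀ j ∈ s, 0 ≤ γ j) (hΓ : 0 < ∑ j ∈ s, γ j) :
    Set.InjOn (logSum s γ ξ) upperHalf :=
  injOn_of_im_deriv_neg convex_upperHalf (fun _ hz => hasDerivAt hz)
    fun _ hz => im_deriv_neg hγ hΓ hz

theorem im_eq (z : ℂ) : (logSum s γ ξ z).im = ∑ j ∈ s, γ j * (z - ξ j).arg := by
  simp [logSum, Complex.im_sum, Complex.log_im]

theorem re_eq (z : ℂ) : (logSum s γ ξ z).re = ∑ j ∈ s, γ j * Real.log ‖z - ξ j‖ := by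
  simp [logSum, Complex.re_sum, Complex.log_re]

theorem re_ofReal (x : ℝ) : (logSum s γ ξ x).re = ∑ j ∈ s, γ j * Real.log |x - ξ j| := by
  rw [re_eq]
  refine Finset.sum_congr rfl fun j _ => ?_
  rw [← Complex.ofReal_sub, Complex.norm_real, Real.norm_eq_abs]

/-- The argument of `x - ξ j` is `π` to the left of the node and `0` to the right. At the node `arg
0 = 0`, so the step function takes its right-hand value. -/
theorem im_ofReal (x : ℝ) :
    (logSum s γ ξ x).im = Real.pi * ∑ j ∈ s with x < ξ j, γ j := by
  rw [im_eq, Finset.sum_filter, Finset.mul_sum]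
  refine Finset.sum_congr rfl fun j _ => ?_
  rw [← Complex.ofReal_sub]
  split_ifs with h
  · rw [Complex.arg_ofReal_of_neg (sub_neg.2 h), mul_comm]
  · rw [Complex.arg_ofReal_of_nonneg (sub_nonneg.2 (not_lt.1 h)), mul_zero, mul_zero]

theorem arg_mem {z : ℂ} (hz : 0 < z.im) : z.arg ∈ Set.Ioo 0 Real.pi := by
  refine ⟨lt_of_le_of_ne (Complex.arg_nonneg_iff.2 hz.le) fun h => ?_,
    Complex.arg_lt_pi_iff.2 (Or.inr hz.ne')⟩
  exact hz.ne' (Complex.arg_eq_zero_iff.1 h.symm).2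

theorem im_mem (hγ : ∀ j ∈ s, 0 ≤ γ j) (hΓ : 0 < ∑ j ∈ s, γ j) {z : ℂ} (hz : z ∈ upperHalf) :
    0 < (logSum s γ ξ z).im ∧ (logSum s γ ξ z).im < (∑ j ∈ s, γ j) * Real.pi := by
  obtain ⟨i, hi, hi0⟩ : ∃ i ∈ s, γ i ≠ 0 := Finset.exists_ne_zero_of_sum_ne_zero hΓ.ne'
  have hi1 : 0 < γ i := lt_of_le_of_ne (hγ i hi) (Ne.symm hi0)
  have h := fun j => arg_mem (sub_mem_upperHalf hz (ξ j))
  rw [im_eq, Finset.sum_mul]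
  exact ⟨Finset.sum_pos' (fun j hj => mul_nonneg (hγ j hj) (h j).1.le) ⟨i, hi, mul_pos hi1 (h i).1⟩,
    Finset.sum_lt_sum (fun j hj => mul_le_mul_of_nonneg_left (h j).2.le (hγ j hj))
      ⟨i, hi, mul_lt_mul_of_pos_left (h i).2 hi1⟩⟩

theorem tendsto_log_sub {x a : ℝ} (h : a ≠ x) :
    Tendsto (fun z : ℂ => Complex.log (z - a)) (𝓝[upperHalf] (x : ℂ))
      (𝓝 (Complex.log ((x : ℂ) - a))) := by
  -- The principal logarithm is continuous up to the negative axis when approached within `0 ≤ im`.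
  have h1 : Tendsto (fun z : ℂ => z - a) (𝓝[upperHalf] (x : ℂ))
      (𝓝[{z : ℂ | 0 ≤ z.im}] ((x : ℂ) - a)) := by
    refine tendsto_nhdsWithin_iff.2 ⟨?_, ?_⟩
    · exact ((continuous_id.sub continuous_const).tendsto _).mono_left nhdsWithin_le_nhds
    · filter_upwards [self_mem_nhdsWithin] with z hz
      exact (sub_mem_upperHalf hz a).le
  refine Tendsto.comp (g := Complex.log) ?_ h1
  rw [← Complex.ofReal_sub]
  rcases lt_or_gt_of_ne (sub_ne_zero.2 h.symm) with hneg | hpos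
  · exact Complex.continuousWithinAt_log_of_re_neg_of_im_zero (by simpa using hneg) (by simp)
  · exact (continuousAt_clog (Or.inl (by simpa using hpos))).mono_left nhdsWithin_le_nhds

/-- Nodes of weight zero impose no condition; this covers the endpoints when `α = 0` or `β = 0`. -/
theorem tendsto_regular {x : ℝ} (h : ∀ j ∈ s, γ j ≠ 0 → ξ j ≠ x) :
    Tendsto (logSum s γ ξ) (𝓝[upperHalf] (x : ℂ)) (𝓝 (logSum s γ ξ x)) := by
  refine tendsto_finsetSum _ fun j hj => ?_
  by_cases h0 : γ j = 0
  · simp [h0]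
  · exact (tendsto_log_sub (h j hj h0)).const_mul _

theorem eq_add_erase {k : ℕ} (hk : k ∈ s) (z : ℂ) :
    logSum s γ ξ z = γ k * Complex.log (z - ξ k) + logSum (s.erase k) γ ξ z :=
  (Finset.add_sum_erase s (fun j => (γ j : ℂ) * Complex.log (z - ξ j)) hk).symm

theorem erase_regular (hξ : Function.Injective ξ) (k : ℕ) :
    ∀ j ∈ s.erase k, γ j ≠ 0 → ξ j ≠ ξ k :=
  fun _ hj _ => hξ.ne (Finset.ne_of_mem_erase hj)

theorem tendsto_re_singular (hξ : Function.Injective ξ) {k : ℕ} (hk : k ∈ s) (hγ : 0 < γ k) :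
    Tendsto (fun z => (logSum s γ ξ z).re) (𝓝[upperHalf] (ξ k : ℂ)) atBot := by
  have h1 : Tendsto (fun z : ℂ => ‖z - ξ k‖) (𝓝[upperHalf] (ξ k : ℂ)) (𝓝[>] 0) := by
    refine tendsto_nhdsWithin_iff.2 ⟨?_, ?_⟩
    · have : Continuous fun z : ℂ => ‖z - ξ k‖ := by fun_prop
      have h := this.tendsto (ξ k)
      simp only [sub_self, norm_zero] at h
      exact h.mono_left nhdsWithin_le_nhds
    · filter_upwards [self_mem_nhdsWithin] with z hz
      have h := sub_mem_upperHalf hz (ξ k)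
      refine norm_pos_iff.2 fun hc => ?_
      rw [hc] at h
      simp at h
  have h2 := (Real.tendsto_log_nhdsGT_zero.comp h1).const_mul_atBot hγ
  have h3 := (Complex.continuous_re.tendsto _).comp
    (tendsto_regular (s := s.erase k) (γ := γ) (erase_regular hξ k))
  refine (h2.atBot_add h3).congr fun z => ?_
  rw [eq_add_erase hk, Complex.add_re, Complex.re_ofReal_mul, Complex.log_re]
  rfl

/-- On the vertical ray the singular term has argument exactly `π / 2`. So the curve enters the
half-strip of the node at mid-height, which later identifies the half-strip. -/
theorem tendsto_im_vertical (hξ : Function.Injective ξ) {k : ℕ} (hk : k ∈ s) :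
    Tendsto (fun ε : ℝ => (logSum s γ ξ (ξ k + ε * Complex.I)).im) (𝓝[>] 0)
      (𝓝 (γ k * (Real.pi / 2) + (logSum (s.erase k) γ ξ (ξ k)).im)) := by
  have h1 := ((Complex.continuous_im.tendsto _).comp
    (tendsto_regular (s := s.erase k) (γ := γ) (erase_regular hξ k))).comp (tendsto_vertical (ξ k))
  refine (h1.const_add (γ k * (Real.pi / 2))).congr' ?_
  filter_upwards [self_mem_nhdsWithin] with ε hε
  rw [eq_add_erase hk, Complex.add_im, Complex.im_ofReal_mul, Complex.log_im, add_sub_cancel_left,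
    Complex.arg_real_mul _ hε, Complex.arg_I]
  rfl

theorem sum_log_lt (hγ : ∀ j ∈ s, 0 ≤ γ j) (hΓ : 0 < ∑ j ∈ s, γ j)
    {a b : ℕ → ℝ} (hab : ∀ j ∈ s, γ j ≠ 0 → 0 < a j ∧ a j < b j) :
    ∑ j ∈ s, γ j * Real.log (a j) < ∑ j ∈ s, γ j * Real.log (b j) := by
  obtain ⟨i, hi, hi0⟩ : ∃ i ∈ s, γ i ≠ 0 := Finset.exists_ne_zero_of_sum_ne_zero hΓ.ne'
  have hlog : ∀ j ∈ s, γ j ≠ 0 → γ j * Real.log (a j) < γ j * Real.log (b j) := fun j hj hj0 =>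
    mul_lt_mul_of_pos_left (Real.log_lt_log (hab j hj hj0).1 (hab j hj hj0).2)
      (lt_of_le_of_ne (hγ j hj) (Ne.symm hj0))
  refine Finset.sum_lt_sum (fun j hj => ?_) ⟨i, hi, hlog i hi hi0⟩
  by_cases hj0 : γ j = 0
  · rw [hj0, zero_mul, zero_mul]
  · exact (hlog j hj hj0).le

theorem log_sub_sub_log_isBigO (a : ℝ) :
    (fun z : ℂ => Complex.log (z - a) - Complex.log z) =O[atInftyUpper] fun z : ℂ => z⁻¹ := by
  have hlarge : ∀ᶠ z in atInftyUpper, 2 * |a| + 1 ≤ ‖z‖ :=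
    Eventually.filter_mono inf_le_left
      (tendsto_norm_cobounded_atTop.eventually (eventually_ge_atTop _))
  have hup : ∀ᶠ z in atInftyUpper, z ∈ upperHalf :=
    Eventually.filter_mono inf_le_right (mem_principal_self _)
  refine Asymptotics.IsBigO.of_bound (3 / 2 * |a|) ?_
  filter_upwards [hlarge, hup] with z hz hzu
  have hz0 : z ≠ 0 := by
    rw [← norm_pos_iff]
    linarith [abs_nonneg a]
  have hza := sub_mem_upperHalf hzu a
  have hza0 : z - a ≠ 0 := by
    intro hc
    rw [hc] at hza
    simp at hza
  have hu : ‖-(a : ℂ) * z⁻¹‖ ≤ 1 / 2 := by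
    rw [norm_mul, norm_neg, Complex.norm_real, Real.norm_eq_abs, norm_inv, ← div_eq_mul_inv,
      div_le_iff₀ (norm_pos_iff.2 hz0)]
    linarith
  have h1 := arg_mem hza
  have h2 := arg_mem (show 0 < z.im from hzu)
  have harg : (z⁻¹).arg = -z.arg := by
    rw [Complex.arg_inv, if_neg h2.2.ne]
  -- Both arguments lie in `(0, π)`, so their difference stays inside `(-π, π)` and no multiple of
  -- `2πi` appears.
  have hlog : Complex.log (z - a) - Complex.log z = Complex.log (1 + -(a : ℂ) * z⁻¹) := by
    have h3 : (z - a) * z⁻¹ = 1 + -(a : ℂ) * z⁻¹ := by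
      field_simp
      ring
    rw [← h3, (Complex.log_mul_eq_add_log_iff hza0 (inv_ne_zero hz0)).2, Complex.log_inv z h2.2.ne,
      sub_eq_add_neg]
    rw [harg]
    constructor <;> linarith [h1.1, h1.2, h2.1, h2.2]
  rw [hlog]
  refine (Complex.norm_log_one_add_half_le_self hu).trans_eq ?_
  rw [norm_mul, norm_neg, Complex.norm_real, Real.norm_eq_abs, mul_assoc]

theorem sub_log_isBigO :
    (fun z : ℂ => logSum s γ ξ z - ((∑ j ∈ s, γ j : ℝ) : ℂ) * Complex.log z) =O[atInftyUpper]
      fun z : ℂ => z⁻¹ := by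
  have h : ∀ z : ℂ, logSum s γ ξ z - ((∑ j ∈ s, γ j : ℝ) : ℂ) * Complex.log z
      = ∑ j ∈ s, (γ j : ℂ) * (Complex.log (z - ξ j) - Complex.log z) := by
    intro z
    simp only [logSum, mul_sub, Finset.sum_sub_distrib]
    push_cast
    rw [Finset.sum_mul]
  simp only [h]
  exact Asymptotics.IsBigO.fun_sum fun j _ => (log_sub_sub_log_isBigO (ξ j)).const_mul_left _

theorem tendsto_re_infty (hΓ : 0 < ∑ j ∈ s, γ j) :
    Tendsto (fun z => (logSum s γ ξ z).re) atInftyUpper atTop := by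
  have hinv : Tendsto (fun z : ℂ => z⁻¹) atInftyUpper (𝓝 0) :=
    tendsto_inv₀_cobounded.mono_left inf_le_left
  have h1 := (sub_log_isBigO (s := s) (γ := γ) (ξ := ξ)).trans_tendsto hinv
  have h2 := (Complex.continuous_re.tendsto _).comp h1
  have h3 : Tendsto (fun z : ℂ => Real.log ‖z‖) atInftyUpper atTop :=
    Real.tendsto_log_atTop.comp (tendsto_norm_cobounded_atTop.mono_left inf_le_left)
  refine ((h3.const_mul_atTop hΓ).atTop_add h2).congr fun z => ?_
  simp only [Function.comp_apply, Complex.sub_re, Complex.re_ofReal_mul, Complex.log_re]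
  ring

end logSum

/-! ### Topology of the comb domain -/

theorem mem_combDomain_iff {n : ℕ} {α β : ℝ} {w : ℂ} : w ∈ combDomain n α β ↔
    (-β < w.im / Real.pi ∧ w.im / Real.pi < α + n) ∧
      ∀ j ≤ n, w.im / Real.pi = j → 0 < w.re := by
  simp only [combDomain, Set.mem_sdiff, Set.mem_iUnion, Set.mem_ofPred_eq, Finset.mem_range,
    Nat.lt_succ_iff, not_exists, not_and, not_le, exists_prop]

/-- The part with positive real part is convex, and the horizontal ray to the right of any point
stays in the domain and reaches that part. -/
theorem isPreconnected_combDomain (n : ℕ) (α β : ℝ) : IsPreconnected (combDomain n α β) := by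
  set H : Set ℂ := {w | (-β < w.im / Real.pi ∧ w.im / Real.pi < α + n) ∧ 0 < w.re} with hH
  have hconv : Convex ℝ H := by
    have h1 : Convex ℝ {w : ℂ | -β * Real.pi < w.im} := convex_halfSpace_im_gt _
    have h2 : Convex ℝ {w : ℂ | w.im < (α + n) * Real.pi} := convex_halfSpace_im_lt _
    have h3 : Convex ℝ {w : ℂ | 0 < w.re} := convex_halfSpace_re_gt _
    convert (h1.inter h2).inter h3 using 1
    ext w
    simp only [hH, Set.mem_ofPred_eq, Set.mem_inter_iff, lt_div_iff₀ Real.pi_pos,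
      div_lt_iff₀ Real.pi_pos]
  have hHsub : H ⊆ combDomain n α β := fun w hw => mem_combDomain_iff.2 ⟨hw.1, fun _ _ _ => hw.2⟩
  have hray : ∀ w ∈ combDomain n α β, ∃ t ⊆ combDomain n α β, w ∈ t ∧ H ⊆ t ∧ IsPreconnected t := by
    intro w hw
    have hw' := mem_combDomain_iff.1 hw
    set r : Set ℂ := (fun s : ℝ => w + s) '' Set.Ici 0 with hr
    have hrsub : r ⊆ combDomain n α β := by
      rintro _ ⟨s, hs, rfl⟩
      rw [mem_combDomain_iff]
      simp only [Complex.add_im, Complex.ofReal_im, add_zero, Complex.add_re, Complex.ofReal_re]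
      exact ⟨hw'.1, fun j hj h => add_pos_of_pos_of_nonneg (hw'.2 j hj h) hs⟩
    have hrpre : IsPreconnected r := isPreconnected_Ici.image _ (by fun_prop)
    refine ⟨r ∪ H, Set.union_subset hrsub hHsub, Or.inl ⟨0, Set.self_mem_Ici, by simp⟩,
      Set.subset_union_right, ?_⟩
    have h1 : w + ((|w.re| + 1 : ℝ) : ℂ) ∈ r := ⟨|w.re| + 1, by
      rw [Set.mem_Ici]; positivity, rfl⟩
    refine hrpre.union _ h1 ⟨?_, ?_⟩ hconv.isPreconnected
    · simpa using hw'.1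
    · simp only [Complex.add_re, Complex.ofReal_re]
      linarith [neg_abs_le w.re]
  by_cases hne : H.Nonempty
  · obtain ⟨x, hx⟩ := hne
    refine isPreconnected_of_forall x fun y hy => ?_
    obtain ⟨t, ht, hy', hHt, hpre⟩ := hray y hy
    exact ⟨t, ht, hHt hx, hy', hpre⟩
  · have : combDomain n α β = ∅ := by
      refine Set.eq_empty_of_forall_notMem fun w hw => hne ?_
      have hw' := mem_combDomain_iff.1 hw
      exact ⟨⟨1, w.im⟩, hw'.1, one_pos⟩
    rw [this]
    exact isPreconnected_empty

theorem map_nhds_eq_of_deriv_ne_zero {f : ℂ → ℂ} {U : Set ℂ} (hU : IsOpen U)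
    (hf : DifferentiableOn ℂ f U) {z : ℂ} (hz : z ∈ U) (hd : deriv f z ≠ 0) :
    map f (𝓝 z) = 𝓝 (f z) :=
  (hf.analyticAt (hU.mem_nhds hz)).hasStrictDerivAt.map_nhds_eq hd

theorem exists_ultrafilter_of_mem_closure_image {X Y : Type*} [TopologicalSpace Y] {f : X → Y}
    {s : Set X} {y : Y} (hy : y ∈ closure (f '' s)) :
    ∃ F : Ultrafilter X, s ∈ F ∧ Tendsto f F (𝓝 y) := by
  have hne : (comap f (𝓝 y) ⊓ 𝓟 s).NeBot := by
    rw [← map_neBot_iff f, Filter.push_pull']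
    rw [map_principal]
    exact mem_closure_iff_clusterPt.1 hy
  refine ⟨Ultrafilter.of (comap f (𝓝 y) ⊓ 𝓟 s), ?_, ?_⟩
  · exact (Ultrafilter.of_le _) (mem_inf_of_right (mem_principal_self s))
  · exact tendsto_comap.mono_left ((Ultrafilter.of_le _).trans inf_le_left)

/-! ### The explicit map and its boundary values -/

/-- The exponents `α, 1, …, 1, β` of the zeros of `t ^ α (t - ξ 1) ⋯ (t - ξ n) (1 - t) ^ β`. -/
noncomputable def jacobiExponent (n : ℕ) (α β : ℝ) (j : ℕ) : ℝ :=
  if j = 0 then α else if j = n + 1 then β else 1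

/-- The explicit conformal mapping onto the comb domain. -/
noncomputable def combMap (n : ℕ) (α β : ℝ) (ξ : ℕ → ℝ) (C : ℝ) (z : ℂ) : ℂ :=
  logSum (Finset.range (n + 2)) (jacobiExponent n α β) ξ z + (C - β * Real.pi * Complex.I)

/-- The function `t ^ α (1 - t) ^ β e ^ C (t - ξ 1) ⋯ (t - ξ n)`. -/
noncomputable def jacobiFun (n : ℕ) (α β : ℝ) (ξ : ℕ → ℝ) (C t : ℝ) : ℝ :=
  t ^ α * (1 - t) ^ β * Real.exp C * ∏ j ∈ Finset.Icc 1 n, (t - ξ j)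

section Exponent

variable {n : ℕ} {α β : ℝ}

theorem jacobiExponent_nonneg (hα : 0 ≤ α) (hβ : 0 ≤ β) (j : ℕ) : 0 ≤ jacobiExponent n α β j := by
  unfold jacobiExponent
  split_ifs <;> first | assumption | exact zero_le_one

theorem jacobiExponent_mid {j : ℕ} (hj : j ∈ Finset.Icc 1 n) : jacobiExponent n α β j = 1 := by
  rw [Finset.mem_Icc] at hj
  rw [jacobiExponent, if_neg (by omega), if_neg (by omega)]

theorem jacobiExponent_zero : jacobiExponent n α β 0 = α := if_pos rfl

theorem jacobiExponent_last : jacobiExponent n α β (n + 1) = β := by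
  simp [jacobiExponent]

theorem sum_jacobiExponent_Ioc {k : ℕ} (hk : k ≤ n) :
    ∑ j ∈ Finset.Ioc k (n + 1), jacobiExponent n α β j = n - k + β := by
  rw [Finset.sum_Ioc_succ_top hk, jacobiExponent_last, Finset.sum_congr rfl (g := fun _ => (1 : ℝ))]
  · rw [Finset.sum_const, Nat.card_Ioc, nsmul_eq_mul, mul_one, Nat.cast_sub hk]
  · intro j hj
    rw [Finset.mem_Ioc] at hj
    exact jacobiExponent_mid (Finset.mem_Icc.2 (by omega))

theorem sum_jacobiExponent :
    ∑ j ∈ Finset.range (n + 2), jacobiExponent n α β j = α + β + n := by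
  rw [Finset.range_eq_Ico, Finset.sum_eq_sum_Ico_succ_bot (by omega), jacobiExponent_zero]
  have := sum_jacobiExponent_Ioc (α := α) (β := β) (Nat.zero_le n)
  rw [show Finset.Ico (0 + 1) (n + 2) = Finset.Ioc 0 (n + 1) by ext; simp; omega, this]
  push_cast
  ring

end Exponent

section CombMap

variable {n : ℕ} {α β C : ℝ} {ξ : ℕ → ℝ}

theorem combMap_differentiableOn : DifferentiableOn ℂ (combMap n α β ξ C) upperHalf := fun _ hz =>
  ((logSum.hasDerivAt hz).add_const _).differentiableAt.differentiableWithinAt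

theorem combMap_injOn (hα : 0 ≤ α) (hβ : 0 ≤ β) (hpos : 0 < α + β + n) :
    Set.InjOn (combMap n α β ξ C) upperHalf := by
  have h := logSum.injOn (ξ := ξ) (fun j _ => jacobiExponent_nonneg hα hβ j)
    (by rwa [sum_jacobiExponent] : 0 < ∑ j ∈ Finset.range (n + 2), jacobiExponent n α β j)
  exact fun a ha b hb hab => h ha hb (add_right_cancel hab)

theorem combMap_map_nhds (hα : 0 ≤ α) (hβ : 0 ≤ β) (hpos : 0 < α + β + n) {z : ℂ}
    (hz : z ∈ upperHalf) :
    map (combMap n α β ξ C) (𝓝 z) = 𝓝 (combMap n α β ξ C z) := by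
  refine map_nhds_eq_of_deriv_ne_zero isOpen_upperHalf combMap_differentiableOn hz ?_
  have h1 := (logSum.hasDerivAt (s := Finset.range (n + 2)) (γ := jacobiExponent n α β) (ξ := ξ)
    hz).add_const ((C : ℂ) - β * Real.pi * Complex.I)
  have h2 := logSum.im_deriv_neg (ξ := ξ) (fun j _ => jacobiExponent_nonneg hα hβ j)
    (by rwa [sum_jacobiExponent] : 0 < ∑ j ∈ Finset.range (n + 2), jacobiExponent n α β j) hz
  intro hc
  have h3 : deriv (combMap n α β ξ C) z = _ := h1.deriv
  rw [← h3, hc] at h2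
  simp at h2

theorem combMap_re (z : ℂ) : (combMap n α β ξ C z).re =
    (logSum (Finset.range (n + 2)) (jacobiExponent n α β) ξ z).re + C := by
  simp [combMap]

theorem combMap_im (z : ℂ) : (combMap n α β ξ C z).im =
    (logSum (Finset.range (n + 2)) (jacobiExponent n α β) ξ z).im - β * Real.pi := by
  simp [combMap, sub_eq_add_neg]

theorem combMap_im_mem (hα : 0 ≤ α) (hβ : 0 ≤ β) (hpos : 0 < α + β + n) {z : ℂ}
    (hz : z ∈ upperHalf) : -β < (combMap n α β ξ C z).im / Real.pi ∧
      (combMap n α β ξ C z).im / Real.pi < α + n := by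
  have h := logSum.im_mem (ξ := ξ) (fun j _ => jacobiExponent_nonneg hα hβ j)
    (by rwa [sum_jacobiExponent] : 0 < ∑ j ∈ Finset.range (n + 2), jacobiExponent n α β j) hz
  rw [sum_jacobiExponent] at h
  rw [combMap_im, lt_div_iff₀ Real.pi_pos, div_lt_iff₀ Real.pi_pos]
  constructor <;> linarith [h.1, h.2]

theorem exp_combMap (h0 : ξ 0 = 0) (h1 : ξ (n + 1) = 1) {z : ℂ} (hz : z ∈ upperHalf) :
    Complex.exp (combMap n α β ξ C z) =
      z ^ (α : ℂ) * (1 - z) ^ (β : ℂ) * Real.exp C * ∏ j ∈ Finset.Icc 1 n, (z - ξ j) := by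
  have hne : ∀ a : ℝ, z - a ≠ 0 := by
    intro a hc
    have := logSum.sub_mem_upperHalf hz a
    rw [hc] at this
    simp at this
  -- The map uses `log (z - 1)`, the formula the principal power of `1 - z`; their difference is
  -- what the constant `-βπi` compensates.
  have hlog : Complex.log (1 - z) = Complex.log (z - 1) - Real.pi * Complex.I := by
    have him : 0 < (z - 1).im := by simpa using logSum.sub_mem_upperHalf hz 1
    rw [← neg_sub z 1, Complex.log, Complex.log, norm_neg,
      Complex.arg_neg_eq_arg_sub_pi_of_im_pos him]
    push_cast
    ring
  have hz0 : z ≠ 0 := by simpa using hne 0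
  have hz1 : 1 - z ≠ 0 := by
    rw [← neg_sub]
    exact neg_ne_zero.2 (by simpa using hne 1)
  rw [Complex.cpow_def_of_ne_zero hz0, Complex.cpow_def_of_ne_zero hz1, Complex.ofReal_exp,
    ← Complex.exp_add, ← Complex.exp_add]
  have hprod : ∏ j ∈ Finset.Icc 1 n, (z - ξ j)
      = Complex.exp (∑ j ∈ Finset.Ioc 0 n, jacobiExponent n α β j * Complex.log (z - ξ j)) := by
    rw [Complex.exp_sum]
    refine Finset.prod_congr (by ext; simp; omega) fun j hj => ?_
    rw [Finset.mem_Ioc] at hj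
    rw [jacobiExponent_mid (Finset.mem_Icc.2 (by omega)), Complex.ofReal_one, one_mul,
      Complex.exp_log (hne _)]
  rw [hprod, ← Complex.exp_add, combMap, logSum, Finset.range_eq_Ico,
    Finset.sum_eq_sum_Ico_succ_bot (by omega),
    show Finset.Ico (0 + 1) (n + 2) = Finset.Ioc 0 (n + 1) by ext; simp; omega,
    Finset.sum_Ioc_succ_top (Nat.zero_le n), jacobiExponent_zero, jacobiExponent_last, h0, h1, hlog]
  congr 1
  push_cast
  rw [sub_zero]
  ring

theorem continuousAt_cpow_ofReal {a : ℝ} (ha : 0 ≤ a) {t : ℝ} (ht : 0 ≤ t) :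
    ContinuousAt (fun z : ℂ => z ^ (a : ℂ)) t := by
  rcases ha.eq_or_lt with rfl | ha
  · simpa using continuousAt_const
  rcases ht.eq_or_lt with rfl | ht
  · exact Complex.continuousAt_cpow_const_of_re_pos (by simp) (by simpa using ha)
  · exact continuousAt_cpow_const (Or.inl (by simpa using ht))

theorem tendsto_exp_combMap (hα : 0 ≤ α) (hβ : 0 ≤ β) (h0 : ξ 0 = 0) (h1 : ξ (n + 1) = 1) {t : ℝ}
    (ht : t ∈ Set.Icc (0 : ℝ) 1) :
    Tendsto (fun z => Complex.exp (combMap n α β ξ C z)) (𝓝[upperHalf] (t : ℂ))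
      (𝓝 (jacobiFun n α β ξ C t : ℂ)) := by
  have h1t : (0 : ℝ) ≤ 1 - t := sub_nonneg.2 ht.2
  have hc : ContinuousAt (fun z : ℂ => z ^ (α : ℂ) * (1 - z) ^ (β : ℂ) * Real.exp C *
      ∏ j ∈ Finset.Icc 1 n, (z - ξ j)) t := by
    refine ((ContinuousAt.mul (continuousAt_cpow_ofReal hα ht.1) ?_).mul continuousAt_const).mul
      (by fun_prop)
    have h2 := continuousAt_cpow_ofReal hβ h1t
    rw [Complex.ofReal_sub, Complex.ofReal_one] at h2
    exact ContinuousAt.comp (g := fun z : ℂ => z ^ (β : ℂ)) h2 (by fun_prop)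
  have hval : (jacobiFun n α β ξ C t : ℂ) = (t : ℂ) ^ (α : ℂ) * (1 - (t : ℂ)) ^ (β : ℂ) *
      Real.exp C * ∏ j ∈ Finset.Icc 1 n, ((t : ℂ) - ξ j) := by
    rw [jacobiFun]
    push_cast [Complex.ofReal_cpow ht.1, Complex.ofReal_cpow h1t]
    rfl
  rw [hval]
  refine (Tendsto.mono_left hc nhdsWithin_le_nhds).congr' ?_
  filter_upwards [self_mem_nhdsWithin] with z hz
  exact (exp_combMap h0 h1 hz).symm

theorem tendsto_combMap {x : ℝ}
    (h : ∀ j ∈ Finset.range (n + 2), jacobiExponent n α β j ≠ 0 → ξ j ≠ x) :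
    Tendsto (combMap n α β ξ C) (𝓝[upperHalf] (x : ℂ)) (𝓝 (combMap n α β ξ C x)) :=
  (logSum.tendsto_regular h).add_const _

theorem regular_iff_jacobiFun_ne_zero (h0 : ξ 0 = 0) (h1 : ξ (n + 1) = 1) {t : ℝ}
    (ht : t ∈ Set.Icc (0 : ℝ) 1) :
    (∀ j ∈ Finset.range (n + 2), jacobiExponent n α β j ≠ 0 → ξ j ≠ t) ↔
      jacobiFun n α β ξ C t ≠ 0 := by
  have h1t : (0 : ℝ) ≤ 1 - t := sub_nonneg.2 ht.2
  have hα' : t ^ α ≠ 0 ↔ (α ≠ 0 → t ≠ 0) := by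
    rw [Ne, Real.rpow_eq_zero_iff_of_nonneg ht.1]; tauto
  have hβ' : (1 - t) ^ β ≠ 0 ↔ (β ≠ 0 → t ≠ 1) := by
    rw [Ne, Real.rpow_eq_zero_iff_of_nonneg h1t, sub_eq_zero, eq_comm]; tauto
  rw [jacobiFun, mul_ne_zero_iff, mul_ne_zero_iff, mul_ne_zero_iff, hα', hβ', Finset.prod_ne_zero_iff]
  constructor
  · intro h
    refine ⟨⟨⟨fun ha hc => ?_, fun hb hc => ?_⟩, (Real.exp_pos C).ne'⟩, fun j hj hc => ?_⟩
    · exact h 0 (by simp) (by rwa [jacobiExponent_zero]) (by rw [h0, hc])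
    · exact h (n + 1) (by simp) (by rwa [jacobiExponent_last]) (by rw [h1, hc])
    · refine h j ?_ (by rw [jacobiExponent_mid hj]; exact one_ne_zero) (sub_eq_zero.1 hc).symm
      rw [Finset.mem_Icc] at hj
      rw [Finset.mem_range]; omega
  · rintro ⟨⟨⟨ha, hb⟩, -⟩, hp⟩ j hj hj0 hc
    rw [Finset.mem_range] at hj
    by_cases hj1 : j = 0
    · subst hj1
      rw [jacobiExponent_zero] at hj0
      exact ha hj0 (by rw [← hc, h0])
    by_cases hj2 : j = n + 1
    · subst hj2
      rw [jacobiExponent_last] at hj0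
      exact hb hj0 (by rw [← hc, h1])
    · exact hp j (Finset.mem_Icc.2 (by omega)) (sub_eq_zero.2 hc.symm)

theorem exp_combMap_ofReal (hα : 0 ≤ α) (hβ : 0 ≤ β) (h0 : ξ 0 = 0) (h1 : ξ (n + 1) = 1) {t : ℝ}
    (ht : t ∈ Set.Icc (0 : ℝ) 1) (hne : jacobiFun n α β ξ C t ≠ 0) :
    Complex.exp (combMap n α β ξ C t) = (jacobiFun n α β ξ C t : ℂ) :=
  tendsto_nhds_unique ((Complex.continuous_exp.tendsto _).comp
    (tendsto_combMap ((regular_iff_jacobiFun_ne_zero h0 h1 ht).2 hne)))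
    (tendsto_exp_combMap hα hβ h0 h1 ht)

theorem exp_combMap_re (hα : 0 ≤ α) (hβ : 0 ≤ β) (h0 : ξ 0 = 0) (h1 : ξ (n + 1) = 1) {t : ℝ}
    (ht : t ∈ Set.Icc (0 : ℝ) 1) (hne : jacobiFun n α β ξ C t ≠ 0) :
    Real.exp (combMap n α β ξ C t).re = |jacobiFun n α β ξ C t| := by
  rw [← Complex.norm_exp, exp_combMap_ofReal hα hβ h0 h1 ht hne, Complex.norm_real,
    Real.norm_eq_abs]

theorem combMap_im_ofReal (x : ℝ) : (combMap n α β ξ C x).im =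
    (∑ j ∈ Finset.range (n + 2) with x < ξ j, jacobiExponent n α β j - β) * Real.pi := by
  rw [combMap_im, logSum.im_ofReal]
  ring

theorem combMap_im_of_lt (hξ : StrictMono ξ) {x : ℝ} (hx : x < ξ 0) :
    (combMap n α β ξ C x).im = (α + n) * Real.pi := by
  rw [combMap_im_ofReal, Finset.filter_true_of_mem, sum_jacobiExponent]
  · ring
  · exact fun j _ => hx.trans_le (hξ.monotone (Nat.zero_le j))

theorem combMap_im_of_ge (hξ : StrictMono ξ) {x : ℝ} (hx : ξ (n + 1) ≤ x) :
    (combMap n α β ξ C x).im = -β * Real.pi := by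
  rw [combMap_im_ofReal, Finset.filter_false_of_mem, Finset.sum_empty, zero_sub]
  intro j hj
  rw [Finset.mem_range] at hj
  exact not_lt.2 ((hξ.monotone (by omega)).trans hx)

theorem combMap_im_of_mem_Ico (hξ : StrictMono ξ) {k : ℕ} (hk : k ≤ n) {x : ℝ}
    (hx : x ∈ Set.Ico (ξ k) (ξ (k + 1))) :
    (combMap n α β ξ C x).im = ((n : ℝ) - k) * Real.pi := by
  have : (Finset.range (n + 2)).filter (fun j => x < ξ j) = Finset.Ioc k (n + 1) := by
    ext j
    rw [Finset.mem_filter, Finset.mem_range, Finset.mem_Ioc]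
    constructor
    · rintro ⟨h1, h2⟩
      refine ⟨?_, by omega⟩
      exact hξ.lt_iff_lt.1 (hx.1.trans_lt h2)
    · rintro ⟨h1, h2⟩
      exact ⟨by omega, hx.2.trans_le (hξ.monotone h1)⟩
  rw [combMap_im_ofReal, this, sum_jacobiExponent_Ioc hk]
  ring

/-- Only the right endpoint needs care, as the step function takes right-hand values. There
`jacobiFun` is nonzero only if the endpoint is `1` and `β = 0`, and then the step has height zero.
-/
theorem combMap_im_of_mem_Icc (hξ : StrictMono ξ) (h0 : ξ 0 = 0) (h1 : ξ (n + 1) = 1) {k : ℕ}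
    (hk : k ≤ n) {x : ℝ} (hx : x ∈ Set.Icc (ξ k) (ξ (k + 1))) (hne : jacobiFun n α β ξ C x ≠ 0) :
    (combMap n α β ξ C x).im = ((n : ℝ) - k) * Real.pi := by
  rcases hx.2.lt_or_eq with h | h
  · exact combMap_im_of_mem_Ico hξ hk ⟨hx.1, h⟩
  · have hx01 : x ∈ Set.Icc (0 : ℝ) 1 := by
      rw [← h0, ← h1]
      exact ⟨(hξ.monotone (Nat.zero_le k)).trans hx.1, hx.2.trans (hξ.monotone (by omega))⟩
    have hreg := (regular_iff_jacobiFun_ne_zero h0 h1 hx01).2 hne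
    have hz : jacobiExponent n α β (k + 1) = 0 := by
      by_contra hc
      exact hreg (k + 1) (by rw [Finset.mem_range]; omega) hc h.symm
    have hkn : k = n := by
      by_contra hc
      rw [jacobiExponent_mid (Finset.mem_Icc.2 (by omega))] at hz
      exact one_ne_zero hz
    subst hkn
    rw [jacobiExponent_last] at hz
    rw [combMap_im_of_ge hξ h.symm.le, hz]
    ring

theorem exists_mem_Icc_nodes (h0 : ξ 0 = 0) (h1 : ξ (n + 1) = 1) {x : ℝ}
    (hx : x ∈ Set.Icc (0 : ℝ) 1) : ∃ k ≤ n, x ∈ Set.Icc (ξ k) (ξ (k + 1)) := by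
  classical
  have hex : ∃ k, x ≤ ξ (k + 1) := ⟨n, by rw [h1]; exact hx.2⟩
  refine ⟨Nat.find hex, Nat.find_min' hex (by rw [h1]; exact hx.2), ?_, Nat.find_spec hex⟩
  rcases Nat.eq_zero_or_pos (Nat.find hex) with h | h
  · rw [h, h0]; exact hx.1
  · have h2 := Nat.find_min hex (Nat.sub_lt h one_pos)
    have h3 : Nat.find hex - 1 + 1 = Nat.find hex := Nat.sub_add_cancel h
    rw [h3] at h2
    exact (not_le.1 h2).le

theorem combMap_tendsto_re_singular (hξ : StrictMono ξ) (hα : 0 ≤ α) (hβ : 0 ≤ β) {k : ℕ}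
    (hk : k ∈ Finset.range (n + 2)) (hk0 : jacobiExponent n α β k ≠ 0) :
    Tendsto (fun z => (combMap n α β ξ C z).re) (𝓝[upperHalf] (ξ k : ℂ)) atBot := by
  have h1 := logSum.tendsto_re_singular hξ.injective hk
    (lt_of_le_of_ne (jacobiExponent_nonneg hα hβ k) (Ne.symm hk0))
  simp only [combMap_re]
  exact tendsto_atBot_add_const_right _ _ h1

theorem combMap_tendsto_re_infty (hpos : 0 < α + β + n) :
    Tendsto (fun z => (combMap n α β ξ C z).re) atInftyUpper atTop := by
  simp only [combMap_re]
  exact tendsto_atTop_add_const_right _ _ (logSum.tendsto_re_infty (by rwa [sum_jacobiExponent]))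

theorem continuous_jacobiFun (hα : 0 ≤ α) (hβ : 0 ≤ β) :
    Continuous (jacobiFun n α β ξ C) :=
  ((jacobiWeight_continuous hα hβ).mul continuous_const).mul (by fun_prop)

theorem combMap_re_ofReal (x : ℝ) : (combMap n α β ξ C x).re =
    ∑ j ∈ Finset.range (n + 2), jacobiExponent n α β j * Real.log |x - ξ j| + C := by
  rw [combMap_re, logSum.re_ofReal]

theorem natCast_mul_pi_notMem_combDomain (hα : α = 0) :
    (n : ℂ) * Real.pi * Complex.I ∉ combDomain n α β := by
  intro hc
  have h1 := (mem_combDomain_iff.1 hc).1.2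
  have h2 : ((n : ℂ) * Real.pi * Complex.I).im / Real.pi = n := by
    simp
  rw [h2, hα, zero_add] at h1
  exact lt_irrefl _ h1

theorem zero_notMem_combDomain (hβ : β = 0) : (0 : ℂ) ∉ combDomain n α β := by
  intro hc
  have h1 := (mem_combDomain_iff.1 hc).1.1
  simp [hβ] at h1

end CombMap

/-! ### The explicit map is a bijection onto the comb domain -/

namespace WeightedChebyshev.IsEquioscillating

variable {n : ℕ} {α β M : ℝ} {ξ : ℕ → ℝ}

/-- The constant `-log M` divides by `M`, so extremal points get modulus `1`, that is, real part
`0`: the tips of the slits. -/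
theorem abs_jacobiFun (h : IsEquioscillating (fun t => t ^ α * (1 - t) ^ β) n ξ M) {t : ℝ}
    (ht : t ∈ Set.Icc (0 : ℝ) 1) : |jacobiFun n α β ξ (-Real.log M) t| =
      t ^ α * (1 - t) ^ β * |∏ j ∈ Finset.Icc 1 n, (t - ξ j)| / M := by
  rw [jacobiFun, abs_mul, abs_mul, abs_of_nonneg (jacobiWeight_nonneg α β t ht), Real.abs_exp,
    Real.exp_neg, Real.exp_log h.pos]
  ring

theorem abs_jacobiFun_le (h : IsEquioscillating (fun t => t ^ α * (1 - t) ^ β) n ξ M) {t : ℝ}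
    (ht : t ∈ Set.Icc (0 : ℝ) 1) : |jacobiFun n α β ξ (-Real.log M) t| ≤ 1 := by
  rw [h.abs_jacobiFun ht, div_le_one h.pos]
  exact h.le t ht

theorem Icc_subset {W : ℝ → ℝ} (h : IsEquioscillating W n ξ M) {k : ℕ} (hk : k ≤ n) :
    Set.Icc (ξ k) (ξ (k + 1)) ⊆ Set.Icc (0 : ℝ) 1 := by
  rw [← h.zero, ← h.last]
  exact Set.Icc_subset_Icc (h.strictMono.monotone (Nat.zero_le k))
    (h.strictMono.monotone (by omega))

theorem exists_abs_jacobiFun_eq (h : IsEquioscillating (fun t => t ^ α * (1 - t) ^ β) n ξ M) {k : ℕ}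
    (hk : k ≤ n) : ∃ t ∈ Set.Icc (ξ k) (ξ (k + 1)), |jacobiFun n α β ξ (-Real.log M) t| = 1 := by
  obtain ⟨t, ht, htM⟩ := h.exists_eq k hk
  refine ⟨t, ht, ?_⟩
  rw [h.abs_jacobiFun (h.Icc_subset hk ht), div_eq_one_iff_eq h.pos.ne']
  exact htM

theorem node_pos {W : ℝ → ℝ} (h : IsEquioscillating W n ξ M) {j : ℕ} (hj : j ∈ Finset.Icc 1 n) :
    0 < ξ j ∧ ξ j < 1 := by
  rw [Finset.mem_Icc] at hj
  rw [← h.zero, ← h.last]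
  exact ⟨h.strictMono (by omega), h.strictMono (by omega)⟩

/-- For `α = 0` every remaining factor decreases in modulus on `[0, ξ 1]`, so the maximum on the
first interval is attained at `0`. -/
theorem abs_jacobiFun_zero (h : IsEquioscillating (fun t => t ^ α * (1 - t) ^ β) n ξ M)
    (hβ : 0 ≤ β) (hα : α = 0) : |jacobiFun n α β ξ (-Real.log M) 0| = 1 := by
  refine le_antisymm (h.abs_jacobiFun_le (by simp)) ?_
  obtain ⟨t, ht, ht1⟩ := h.exists_abs_jacobiFun_eq (Nat.zero_le n)
  have ht01 := h.Icc_subset (Nat.zero_le n) ht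
  rw [← ht1, h.abs_jacobiFun ht01, h.abs_jacobiFun (by simp : (0 : ℝ) ∈ Set.Icc (0 : ℝ) 1), hα,
    Real.rpow_zero, Real.rpow_zero, one_mul, one_mul, sub_zero, Real.one_rpow, one_mul]
  refine div_le_div_of_nonneg_right ?_ h.pos.le
  have h1 : (1 - t) ^ β ≤ 1 := Real.rpow_le_one (sub_nonneg.2 ht01.2) (by linarith [ht01.1]) hβ
  have h2 : |∏ j ∈ Finset.Icc 1 n, (t - ξ j)| ≤ |∏ j ∈ Finset.Icc 1 n, (0 - ξ j)| := by
    rw [Finset.abs_prod, Finset.abs_prod]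
    refine Finset.prod_le_prod (fun _ _ => abs_nonneg _) fun j hj => ?_
    have h3 := h.node_pos hj
    have h4 : t ≤ ξ j := ht.2.trans (h.strictMono.monotone (Finset.mem_Icc.1 hj).1)
    rw [abs_of_nonpos (by linarith), abs_of_neg (by linarith)]
    linarith [ht01.1]
  calc _ ≤ 1 * |∏ j ∈ Finset.Icc 1 n, (t - ξ j)| := mul_le_mul_of_nonneg_right h1 (abs_nonneg _)
    _ ≤ _ := by rwa [one_mul]

theorem abs_jacobiFun_one (h : IsEquioscillating (fun t => t ^ α * (1 - t) ^ β) n ξ M)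
    (hα : 0 ≤ α) (hβ : β = 0) : |jacobiFun n α β ξ (-Real.log M) 1| = 1 := by
  refine le_antisymm (h.abs_jacobiFun_le (by simp)) ?_
  obtain ⟨t, ht, ht1⟩ := h.exists_abs_jacobiFun_eq le_rfl
  have ht01 := h.Icc_subset le_rfl ht
  refine ht1.symm.le.trans ?_
  rw [h.abs_jacobiFun ht01, h.abs_jacobiFun (by simp : (1 : ℝ) ∈ Set.Icc (0 : ℝ) 1), hβ,
    Real.rpow_zero, Real.rpow_zero, mul_one, mul_one, Real.one_rpow, one_mul]
  refine div_le_div_of_nonneg_right ?_ h.pos.le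
  have h1 : t ^ α ≤ 1 := Real.rpow_le_one ht01.1 ht01.2 hα
  have h2 : |∏ j ∈ Finset.Icc 1 n, (t - ξ j)| ≤ |∏ j ∈ Finset.Icc 1 n, (1 - ξ j)| := by
    rw [Finset.abs_prod, Finset.abs_prod]
    refine Finset.prod_le_prod (fun _ _ => abs_nonneg _) fun j hj => ?_
    have h3 := h.node_pos hj
    have h4 : ξ j ≤ t := (h.strictMono.monotone (Finset.mem_Icc.1 hj).2).trans ht.1
    rw [abs_of_nonneg (by linarith), abs_of_pos (by linarith)]
    linarith [ht01.2]
  calc _ ≤ 1 * |∏ j ∈ Finset.Icc 1 n, (t - ξ j)| := mul_le_mul_of_nonneg_right h1 (abs_nonneg _)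
    _ ≤ _ := by rwa [one_mul]

/-- The boundary values of the map on the real line lie outside the comb domain. -/
theorem combMap_ofReal_notMem (h : IsEquioscillating (fun t => t ^ α * (1 - t) ^ β) n ξ M)
    (hα : 0 ≤ α) (hβ : 0 ≤ β) {x : ℝ}
    (hx : ∀ j ∈ Finset.range (n + 2), jacobiExponent n α β j ≠ 0 → ξ j ≠ x) :
    combMap n α β ξ (-Real.log M) x ∉ combDomain n α β := by
  rw [mem_combDomain_iff]
  rintro ⟨⟨h1, h2⟩, h3⟩
  rcases lt_or_ge x (ξ 0) with hx0 | hx0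
  · rw [combMap_im_of_lt h.strictMono hx0, mul_div_cancel_right₀ _ Real.pi_ne_zero] at h2
    exact lt_irrefl _ h2
  rcases le_or_gt (ξ (n + 1)) x with hx1 | hx1
  · rw [combMap_im_of_ge h.strictMono hx1, mul_div_cancel_right₀ _ Real.pi_ne_zero] at h1
    exact lt_irrefl _ h1
  have hx01 : x ∈ Set.Icc (0 : ℝ) 1 := by
    rw [← h.zero, ← h.last]; exact ⟨hx0, hx1.le⟩
  have hne := (regular_iff_jacobiFun_ne_zero (C := -Real.log M) h.zero h.last hx01).1 hx
  obtain ⟨k, hk, hxk⟩ := exists_mem_Icc_nodes h.zero h.last hx01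
  have him := combMap_im_of_mem_Icc h.strictMono h.zero h.last hk hxk hne
  have hre := h3 (n - k) (Nat.sub_le n k) (by
    rw [him, mul_div_cancel_right₀ _ Real.pi_ne_zero, Nat.cast_sub hk])
  -- The real part is the logarithm of `|jacobiFun| ≤ 1`, so it is not positive and the value lies
  -- on a slit.
  have h4 := exp_combMap_re hα hβ h.zero h.last hx01 hne
  have h5 := h.abs_jacobiFun_le hx01
  rw [← h4, Real.exp_le_one_iff] at h5
  exact absurd hre (not_lt.2 h5)

/-- Along an ultrafilter of the upper half-plane the map has a limit in its image, a limit outside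
the comb domain, or its real part tends to infinity. -/
theorem ultrafilter_cases (h : IsEquioscillating (fun t => t ^ α * (1 - t) ^ β) n ξ M)
    (hα : 0 ≤ α) (hβ : 0 ≤ β) (hpos : 0 < α + β + n) (F : Ultrafilter ℂ) (hF : upperHalf ∈ F) :
    (∃ z ∈ upperHalf, Tendsto (combMap n α β ξ (-Real.log M)) F
      (𝓝 (combMap n α β ξ (-Real.log M) z))) ∨
    (∃ x : ℝ, (F : Filter ℂ) ≤ 𝓝[upperHalf] (x : ℂ) ∧
      (∀ j ∈ Finset.range (n + 2), jacobiExponent n α β j ≠ 0 → ξ j ≠ x) ∧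
      Tendsto (combMap n α β ξ (-Real.log M)) F (𝓝 (combMap n α β ξ (-Real.log M) x))) ∨
    (∃ j ∈ Finset.range (n + 2), jacobiExponent n α β j ≠ 0 ∧
      (F : Filter ℂ) ≤ 𝓝[upperHalf] (ξ j : ℂ) ∧
      Tendsto (fun z => (combMap n α β ξ (-Real.log M) z).re) F atBot) ∨
    ((F : Filter ℂ) ≤ atInftyUpper ∧
      Tendsto (fun z => (combMap n α β ξ (-Real.log M) z).re) F atTop) := by
  rcases ultrafilter_upperHalf_cases F hF with ⟨z, hz, hFz⟩ | ⟨x, hx⟩ | hinf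
  · refine Or.inl ⟨z, hz, ?_⟩
    have := combMap_map_nhds (ξ := ξ) (C := -Real.log M) hα hβ hpos hz
    exact Tendsto.mono_left this.le hFz
  · by_cases hreg : ∀ j ∈ Finset.range (n + 2), jacobiExponent n α β j ≠ 0 → ξ j ≠ x
    · exact Or.inr (Or.inl ⟨x, hx, hreg, (tendsto_combMap hreg).mono_left hx⟩)
    · push Not at hreg
      obtain ⟨j, hj, hj0, rfl⟩ := hreg
      exact Or.inr (Or.inr (Or.inl ⟨j, hj, hj0, hx,
        (combMap_tendsto_re_singular h.strictMono hα hβ hj hj0).mono_left hx⟩))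
  · exact Or.inr (Or.inr (Or.inr ⟨hinf, (combMap_tendsto_re_infty hpos).mono_left hinf⟩))

/-- The image is open and meets the connected domain, so it suffices that it is relatively closed. A
point of the domain in the closure of the image is a limit along an ultrafilter, which can only
converge inside the half-plane: other limits are boundary values outside the domain, or infinite. -/
theorem combDomain_subset_image (h : IsEquioscillating (fun t => t ^ α * (1 - t) ^ β) n ξ M)
    (hα : 0 ≤ α) (hβ : 0 ≤ β) (hpos : 0 < α + β + n) :
    combDomain n α β ⊆ combMap n α β ξ (-Real.log M) '' upperHalf := by
  refine (isPreconnected_combDomain n α β).subset_of_closure_inter_subset ?_ ?_ ?_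
  · rw [isOpen_iff_mem_nhds]
    rintro _ ⟨z, hz, rfl⟩
    rw [← combMap_map_nhds hα hβ hpos hz]
    exact image_mem_map (isOpen_upperHalf.mem_nhds hz)
  · have h1 := combMap_tendsto_re_infty (ξ := ξ) (C := -Real.log M) hpos
    obtain ⟨z, hz, hzu⟩ := ((h1.eventually (eventually_gt_atTop 0)).and
      (show ∀ᶠ z in atInftyUpper, z ∈ upperHalf from
        Eventually.filter_mono inf_le_right (mem_principal_self _))).exists
    exact ⟨_, mem_combDomain_iff.2 ⟨combMap_im_mem hα hβ hpos hzu, fun _ _ _ => hz⟩, z, hzu, rfl⟩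
  · rintro ω ⟨hω, hωc⟩
    obtain ⟨F, hF, hlim⟩ := exists_ultrafilter_of_mem_closure_image hω
    have hre := (Complex.continuous_re.tendsto ω).comp hlim
    rcases h.ultrafilter_cases hα hβ hpos F hF with
      ⟨z, hz, hz'⟩ | ⟨x, -, hreg, hx⟩ | ⟨j, -, -, -, hj⟩ | ⟨-, hinf⟩
    · exact ⟨z, hz, tendsto_nhds_unique hz' hlim⟩
    · rw [tendsto_nhds_unique hlim hx] at hωc
      exact absurd hωc (h.combMap_ofReal_notMem hα hβ hreg)
    · exact absurd hre (not_tendsto_nhds_of_tendsto_atBot hj _)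
    · exact absurd hre (not_tendsto_nhds_of_tendsto_atTop hinf _)

/-- Every point of a slit is a boundary value. -/
theorem exists_combMap_ofReal_eq (h : IsEquioscillating (fun t => t ^ α * (1 - t) ^ β) n ξ M)
    (hα : 0 ≤ α) (hβ : 0 ≤ β) {ω : ℂ} {k : ℕ} (hk : k ≤ n) (hk0 : jacobiExponent n α β k ≠ 0)
    (him : ω.im = ((n : ℝ) - k) * Real.pi) (hre : ω.re ≤ 0) :
    ∃ x : ℝ, (∀ j ∈ Finset.range (n + 2), jacobiExponent n α β j ≠ 0 → ξ j ≠ x) ∧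
      combMap n α β ξ (-Real.log M) x = ω := by
  obtain ⟨t, ht, ht1⟩ := h.exists_abs_jacobiFun_eq hk
  have hk01 : ξ k ∈ Set.Icc (0 : ℝ) 1 :=
    h.Icc_subset hk ⟨le_rfl, h.strictMono.monotone (Nat.le_succ k)⟩
  have hzero : jacobiFun n α β ξ (-Real.log M) (ξ k) = 0 := by
    by_contra hc
    exact (regular_iff_jacobiFun_ne_zero h.zero h.last hk01).2 hc k
      (by rw [Finset.mem_range]; omega) hk0 rfl
  -- From the node to the extremal point `|jacobiFun|` goes from `0` to `1`, so it takes the value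
  -- `exp ω.re`.
  have hivt := intermediate_value_Icc ht.1
    ((continuous_jacobiFun (n := n) (ξ := ξ) (C := -Real.log M) hα hβ).abs).continuousOn
  rw [hzero, ht1, abs_zero] at hivt
  obtain ⟨x, hx, hxe⟩ := hivt ⟨(Real.exp_pos ω.re).le, Real.exp_le_one_iff.2 hre⟩
  have hxk : x ∈ Set.Icc (ξ k) (ξ (k + 1)) := ⟨hx.1, hx.2.trans ht.2⟩
  have hx01 := h.Icc_subset hk hxk
  have hne : jacobiFun n α β ξ (-Real.log M) x ≠ 0 := by
    rw [← abs_ne_zero]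
    exact hxe.trans_ne (Real.exp_pos _).ne'
  refine ⟨x, (regular_iff_jacobiFun_ne_zero h.zero h.last hx01).2 hne, Complex.ext ?_ ?_⟩
  · exact Real.exp_injective ((exp_combMap_re hα hβ h.zero h.last hx01 hne).trans hxe)
  · rw [combMap_im_of_mem_Icc h.strictMono h.zero h.last hk hxk hne, him]

/-- If an interior point `z` had its value on a slit, that value would also be a boundary value at
some real `x`. By openness, points near `x` would share their values with points near `z`, against
injectivity. -/
theorem combMap_mapsTo (h : IsEquioscillating (fun t => t ^ α * (1 - t) ^ β) n ξ M)
    (hα : 0 ≤ α) (hβ : 0 ≤ β) (hpos : 0 < α + β + n) :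
    Set.MapsTo (combMap n α β ξ (-Real.log M)) upperHalf (combDomain n α β) := by
  intro z hz
  have him := combMap_im_mem (ξ := ξ) (C := -Real.log M) hα hβ hpos hz
  refine mem_combDomain_iff.2 ⟨him, fun j hj hjz => ?_⟩
  by_contra! hre
  -- The slit of height `jπ` belongs to the interval that starts at `ξ (n - j)`. The weight there
  -- vanishes only for `j = n`, `α = 0`, when that height is not inside the strip.
  have hk0 : jacobiExponent n α β (n - j) ≠ 0 := by
    rcases eq_or_lt_of_le hj with rfl | hlt
    · rw [hjz] at him
      rw [Nat.sub_self, jacobiExponent_zero]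
      intro hc
      rw [hc, zero_add] at him
      exact lt_irrefl _ him.2
    · rw [jacobiExponent_mid (Finset.mem_Icc.2 (by omega))]
      exact one_ne_zero
  obtain ⟨x, hx, hxz⟩ := h.exists_combMap_ofReal_eq hα hβ (Nat.sub_le n j) hk0
    (by rw [Nat.cast_sub hj, sub_sub_cancel, ← hjz, div_mul_cancel₀ _ Real.pi_ne_zero]) hre
  have h1 := tendsto_combMap (C := -Real.log M) hx
  rw [hxz, ← combMap_map_nhds hα hβ hpos hz] at h1
  have hV : Metric.ball z (z.im / 2) ∩ upperHalf ∈ 𝓝 z :=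
    inter_mem (Metric.ball_mem_nhds z (half_pos hz)) (isOpen_upperHalf.mem_nhds hz)
  have h2 : ∀ᶠ y in 𝓝[upperHalf] (x : ℂ), combMap n α β ξ (-Real.log M) y ∈
      combMap n α β ξ (-Real.log M) '' (Metric.ball z (z.im / 2) ∩ upperHalf) :=
    h1 (image_mem_map hV)
  have h3 : ∀ᶠ y in 𝓝[upperHalf] (x : ℂ), y.im < z.im / 2 := by
    have : Tendsto Complex.im (𝓝[upperHalf] (x : ℂ)) (𝓝 0) := by
      have := (Complex.continuous_im.tendsto (x : ℂ)).mono_left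
        (nhdsWithin_le_nhds (s := upperHalf))
      rwa [Complex.ofReal_im] at this
    exact this.eventually (gt_mem_nhds (half_pos hz))
  obtain ⟨y, ⟨⟨v, hv, hvy⟩, hy⟩, hyu⟩ :=
    ((h2.and h3).and (self_mem_nhdsWithin (s := upperHalf))).exists
  obtain rfl := combMap_injOn hα hβ hpos hv.2 hyu hvy
  have h4 := (Complex.abs_im_le_norm (v - z)).trans_lt (mem_ball_iff_norm.1 hv.1)
  rw [Complex.sub_im, abs_lt] at h4
  linarith [h4.1]

theorem combMap_bijOn (h : IsEquioscillating (fun t => t ^ α * (1 - t) ^ β) n ξ M)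
    (hα : 0 ≤ α) (hβ : 0 ≤ β) (hpos : 0 < α + β + n) :
    Set.BijOn (combMap n α β ξ (-Real.log M)) upperHalf (combDomain n α β) :=
  ⟨h.combMap_mapsTo hα hβ hpos, combMap_injOn hα hβ hpos, h.combDomain_subset_image hα hβ hpos⟩

end WeightedChebyshev.IsEquioscillating

/-! ### Boundary correspondence at the nodes -/

/-- The lower height of the half-strip between two slits that corresponds to the node `k`. -/
noncomputable def endLower (n : ℕ) (β : ℝ) (k : ℕ) : ℝ := if k = n + 1 then -β else n - k

theorem endLower_of_le {n k : ℕ} {β : ℝ} (hk : k ≤ n) : endLower n β k = n - k :=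
  if_neg (by omega)

theorem endLower_last {n : ℕ} {β : ℝ} : endLower n β (n + 1) = -β := if_pos rfl

theorem midEnd_eq {n j : ℕ} {α β : ℝ} (hj : j ∈ Finset.Icc 1 n) :
    midEnd n j = leftEnd (endLower n β j) (endLower n β j + jacobiExponent n α β j) := by
  rw [midEnd, endLower_of_le (Finset.mem_Icc.1 hj).2, jacobiExponent_mid hj]

theorem topEnd_eq {n : ℕ} {α β : ℝ} (hα : α ≠ 0) :
    topEnd n α = leftEnd (endLower n β 0) (endLower n β 0 + jacobiExponent n α β 0) := by
  rw [topEnd, if_neg hα, endLower_of_le (Nat.zero_le n), jacobiExponent_zero, Nat.cast_zero,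
    sub_zero]

theorem bottomEnd_eq {n : ℕ} {α β : ℝ} (hβ : β ≠ 0) :
    bottomEnd β = leftEnd (endLower n β (n + 1))
      (endLower n β (n + 1) + jacobiExponent n α β (n + 1)) := by
  rw [bottomEnd, if_neg hβ, endLower_last, jacobiExponent_last, neg_add_cancel]

theorem combMap_im_node {n : ℕ} {α β C : ℝ} {ξ : ℕ → ℝ} (hξ : StrictMono ξ) {k : ℕ}
    (hk : k ∈ Finset.range (n + 2)) :
    (combMap n α β ξ C (ξ k)).im = endLower n β k * Real.pi := by
  rw [Finset.mem_range] at hk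
  rcases eq_or_lt_of_le (Nat.lt_succ_iff.1 hk) with rfl | hlt
  · rw [endLower_last, combMap_im_of_ge hξ le_rfl]
  · rw [endLower_of_le (by omega), combMap_im_of_mem_Ico hξ (Nat.lt_succ_iff.1 hlt)
      ⟨le_rfl, hξ (Nat.lt_succ_self k)⟩]

theorem tendsto_combMap_im_vertical {n : ℕ} {α β C : ℝ} {ξ : ℕ → ℝ} (hξ : StrictMono ξ) {k : ℕ}
    (hk : k ∈ Finset.range (n + 2)) :
    Tendsto (fun ε : ℝ => (combMap n α β ξ C (ξ k + ε * Complex.I)).im / Real.pi) (𝓝[>] 0)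
      (𝓝 (endLower n β k + jacobiExponent n α β k / 2)) := by
  have h1 := ((logSum.tendsto_im_vertical (γ := jacobiExponent n α β) hξ.injective hk).sub_const
    (β * Real.pi)).div_const Real.pi
  have h2 : (logSum ((Finset.range (n + 2)).erase k) (jacobiExponent n α β) ξ (ξ k)).im
      = (logSum (Finset.range (n + 2)) (jacobiExponent n α β) ξ (ξ k)).im := by
    rw [logSum.im_ofReal, logSum.im_ofReal, Finset.filter_erase, Finset.erase_eq_of_notMem]
    simp
  have h3 := combMap_im_node (C := C) (α := α) (β := β) hξ hk
  rw [combMap_im] at h3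
  simp only [combMap_im]
  convert h1 using 2
  rw [h2, eq_add_of_sub_eq h3]
  field_simp
  ring

theorem im_ne_of_re_nonpos {n : ℕ} {α β : ℝ} {w : ℂ} (hw : w ∈ combDomain n α β) (hre : w.re ≤ 0) {k : ℕ}
    (hk : k ∈ Finset.range (n + 2)) :
    w.im / Real.pi ≠ endLower n β k ∧
      w.im / Real.pi ≠ endLower n β k + jacobiExponent n α β k := by
  have hw' := mem_combDomain_iff.1 hw
  have hnat : ∀ j ≤ n, w.im / Real.pi ≠ j := fun j hj hc => absurd (hw'.2 j hj hc) (not_lt.2 hre)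
  rw [Finset.mem_range] at hk
  rcases eq_or_lt_of_le (Nat.lt_succ_iff.1 hk) with rfl | hlt
  · rw [endLower_last, jacobiExponent_last, neg_add_cancel]
    exact ⟨hw'.1.1.ne', by exact_mod_cast hnat 0 (Nat.zero_le n)⟩
  · have hkn : k ≤ n := Nat.lt_succ_iff.1 hlt
    rw [endLower_of_le hkn]
    refine ⟨by rw [← Nat.cast_sub hkn]; exact hnat _ (Nat.sub_le n k), ?_⟩
    rcases Nat.eq_zero_or_pos k with rfl | hk0
    · rw [jacobiExponent_zero, Nat.cast_zero, sub_zero, add_comm]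
      exact hw'.1.2.ne
    · rw [jacobiExponent_mid (Finset.mem_Icc.2 ⟨hk0, hkn⟩), ← Nat.cast_sub hkn]
      exact_mod_cast hnat (n - k + 1) (by omega)

/-- The half-strips of different nodes are disjoint, so a limit at a left end determines its node.
-/
theorem endLower_add_le {n : ℕ} {α β : ℝ} {i j : ℕ} (hij : i < j) (hj : j ∈ Finset.range (n + 2)) :
    endLower n β j + jacobiExponent n α β j ≤ endLower n β i := by
  rw [Finset.mem_range] at hj
  rw [endLower_of_le (by omega : i ≤ n)]
  rcases eq_or_lt_of_le (Nat.lt_succ_iff.1 hj) with rfl | hlt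
  · rw [endLower_last, jacobiExponent_last, neg_add_cancel, sub_nonneg]
    exact_mod_cast Nat.lt_succ_iff.1 hij
  · rw [endLower_of_le (by omega), jacobiExponent_mid (Finset.mem_Icc.2 (by omega))]
    have : (i : ℝ) + 1 ≤ j := by exact_mod_cast hij
    linarith

namespace WeightedChebyshev.IsEquioscillating

variable {n : ℕ} {α β M : ℝ} {ξ : ℕ → ℝ}

/-- On a small half-disc at the node the real part is at most `0`, so the image cannot cross the
heights that bound the half-strip. The half-disc is connected, and its vertical radius contains a
point mapped into the half-strip. -/
theorem tendsto_leftEnd (h : IsEquioscillating (fun t => t ^ α * (1 - t) ^ β) n ξ M)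
    (hα : 0 ≤ α) (hβ : 0 ≤ β) (hpos : 0 < α + β + n) {k : ℕ} (hk : k ∈ Finset.range (n + 2))
    (hk0 : jacobiExponent n α β k ≠ 0) :
    Tendsto (combMap n α β ξ (-Real.log M)) (𝓝[upperHalf] (ξ k : ℂ))
      (leftEnd (endLower n β k) (endLower n β k + jacobiExponent n α β k)) := by
  have hre := combMap_tendsto_re_singular (C := -Real.log M) h.strictMono hα hβ hk hk0
  have hγ : 0 < jacobiExponent n α β k :=
    lt_of_le_of_ne (jacobiExponent_nonneg hα hβ k) (Ne.symm hk0)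
  refine tendsto_inf.2 ⟨tendsto_comap_iff.2 hre, tendsto_principal.2 ?_⟩
  obtain ⟨δ, hδ, hball⟩ := Metric.mem_nhdsWithin_iff.1 (hre.eventually (eventually_le_atBot 0))
  set U := Metric.ball (ξ k : ℂ) δ ∩ upperHalf with hU
  set g : ℂ → ℝ := fun z => (combMap n α β ξ (-Real.log M) z).im / Real.pi with hg
  have hpre : IsPreconnected (g '' U) := by
    refine ((convex_ball _ _).inter convex_upperHalf).isPreconnected.image _ ?_
    exact (Complex.continuous_im.comp_continuousOn
      (combMap_differentiableOn.continuousOn.mono Set.inter_subset_right)).div_const _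
  have hUmem : U ∈ 𝓝[upperHalf] (ξ k : ℂ) :=
    inter_mem (mem_nhdsWithin_of_mem_nhds (Metric.ball_mem_nhds _ hδ)) self_mem_nhdsWithin
  obtain ⟨ε, ⟨hε1, hε2⟩, hεU⟩ := (((tendsto_combMap_im_vertical (α := α) (β := β)
    (C := -Real.log M) h.strictMono hk).eventually
    (Ioo_mem_nhds (by linarith : endLower n β k < endLower n β k + jacobiExponent n α β k / 2)
      (by linarith : _ < endLower n β k + jacobiExponent n α β k))).and
    ((tendsto_vertical (ξ k)).eventually hUmem)).exists
  have hord := hpre.ordConnected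
  have hs : g (ξ k + ε * Complex.I) ∈ g '' U := Set.mem_image_of_mem _ hεU
  have havoid : ∀ y ∈ g '' U, y ≠ endLower n β k ∧
      y ≠ endLower n β k + jacobiExponent n α β k := by
    rintro _ ⟨z, hz, rfl⟩
    exact im_ne_of_re_nonpos (h.combMap_mapsTo hα hβ hpos hz.2) (hball hz) hk
  filter_upwards [hUmem] with z hz
  have hz' : g z ∈ g '' U := Set.mem_image_of_mem _ hz
  constructor
  · by_contra! hc
    exact (havoid _ (hord.out hz' hs ⟨hc, hε1.le⟩)).1 rfl
  · by_contra! hc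
    exact (havoid _ (hord.out hs hz' ⟨hε2.le, hc⟩)).2 rfl

theorem combMap_zero (h : IsEquioscillating (fun t => t ^ α * (1 - t) ^ β) n ξ M)
    (hβ : 0 ≤ β) (hα : α = 0) :
    combMap n α β ξ (-Real.log M) (0 : ℝ) = (n : ℂ) * Real.pi * Complex.I := by
  have h01 : (0 : ℝ) ∈ Set.Icc (0 : ℝ) 1 := by simp
  have habs := h.abs_jacobiFun_zero hβ hα
  have hne : jacobiFun n α β ξ (-Real.log M) 0 ≠ 0 := by
    rw [← abs_ne_zero, habs]; exact one_ne_zero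
  have hre := exp_combMap_re hα.ge hβ h.zero h.last h01 hne
  rw [habs, Real.exp_eq_one_iff] at hre
  refine Complex.ext (by rw [hre]; simp) ?_
  rw [combMap_im_of_mem_Ico h.strictMono (Nat.zero_le n)
    ⟨h.zero.le, by rw [← h.zero]; exact h.strictMono one_pos⟩]
  simp

theorem combMap_one (h : IsEquioscillating (fun t => t ^ α * (1 - t) ^ β) n ξ M)
    (hα : 0 ≤ α) (hβ : β = 0) : combMap n α β ξ (-Real.log M) (1 : ℝ) = 0 := by
  have h01 : (1 : ℝ) ∈ Set.Icc (0 : ℝ) 1 := by simp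
  have habs := h.abs_jacobiFun_one hα hβ
  have hne : jacobiFun n α β ξ (-Real.log M) 1 ≠ 0 := by
    rw [← abs_ne_zero, habs]; exact one_ne_zero
  have hre := exp_combMap_re hα hβ.ge h.zero h.last h01 hne
  rw [habs, Real.exp_eq_one_iff] at hre
  refine Complex.ext (by rw [hre]; simp) ?_
  rw [combMap_im_of_ge h.strictMono h.last.le, hβ]
  simp

theorem regular_zero (h : IsEquioscillating (fun t => t ^ α * (1 - t) ^ β) n ξ M) (hα : α = 0) :
    ∀ j ∈ Finset.range (n + 2), jacobiExponent n α β j ≠ 0 → ξ j ≠ 0 := by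
  intro j _ hj0 hc
  rw [← h.zero] at hc
  obtain rfl := h.strictMono.injective hc
  exact hj0 (by rw [jacobiExponent_zero, hα])

theorem regular_one (h : IsEquioscillating (fun t => t ^ α * (1 - t) ^ β) n ξ M) (hβ : β = 0) :
    ∀ j ∈ Finset.range (n + 2), jacobiExponent n α β j ≠ 0 → ξ j ≠ 1 := by
  intro j _ hj0 hc
  rw [← h.last] at hc
  obtain rfl := h.strictMono.injective hc
  exact hj0 (by rw [jacobiExponent_last, hβ])

theorem tendsto_topEnd (h : IsEquioscillating (fun t => t ^ α * (1 - t) ^ β) n ξ M)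
    (hα : 0 ≤ α) (hβ : 0 ≤ β) (hpos : 0 < α + β + n) :
    Tendsto (combMap n α β ξ (-Real.log M)) (𝓝[upperHalf] 0) (topEnd n α) := by
  by_cases h0 : α = 0
  · have h1 := tendsto_combMap (C := -Real.log M) (h.regular_zero h0)
    rw [h.combMap_zero hβ h0, Complex.ofReal_zero] at h1
    rwa [topEnd, if_pos h0]
  · have h1 := h.tendsto_leftEnd hα hβ hpos (k := 0) (by simp) (by rwa [jacobiExponent_zero])
    rw [h.zero, Complex.ofReal_zero] at h1
    rwa [topEnd_eq h0]

theorem tendsto_bottomEnd (h : IsEquioscillating (fun t => t ^ α * (1 - t) ^ β) n ξ M)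
    (hα : 0 ≤ α) (hβ : 0 ≤ β) (hpos : 0 < α + β + n) :
    Tendsto (combMap n α β ξ (-Real.log M)) (𝓝[upperHalf] 1) (bottomEnd β) := by
  by_cases h0 : β = 0
  · have h1 := tendsto_combMap (C := -Real.log M) (h.regular_one h0)
    rw [h.combMap_one hα h0, Complex.ofReal_one] at h1
    rwa [bottomEnd, if_pos h0]
  · have h1 := h.tendsto_leftEnd hα hβ hpos (k := n + 1) (by simp) (by rwa [jacobiExponent_last])
    rw [h.last, Complex.ofReal_one] at h1
    rwa [bottomEnd_eq h0]

theorem tendsto_midEnd (h : IsEquioscillating (fun t => t ^ α * (1 - t) ^ β) n ξ M)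
    (hα : 0 ≤ α) (hβ : 0 ≤ β) (hpos : 0 < α + β + n) {j : ℕ} (hj : j ∈ Finset.Icc 1 n) :
    Tendsto (combMap n α β ξ (-Real.log M)) (𝓝[upperHalf] (ξ j : ℂ)) (midEnd n j) := by
  rw [midEnd_eq (α := α) (β := β) hj]
  refine h.tendsto_leftEnd hα hβ hpos ?_ (by rw [jacobiExponent_mid hj]; exact one_ne_zero)
  rw [Finset.mem_Icc] at hj
  rw [Finset.mem_range]; omega

theorem isCombMap (h : IsEquioscillating (fun t => t ^ α * (1 - t) ^ β) n ξ M)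
    (hα : 0 ≤ α) (hβ : 0 ≤ β) (hpos : 0 < α + β + n) :
    IsCombMap n α β (combMap n α β ξ (-Real.log M)) where
  differentiableOn := combMap_differentiableOn
  bijOn := h.combMap_bijOn hα hβ hpos
  at_zero := h.tendsto_topEnd hα hβ hpos
  at_one := h.tendsto_bottomEnd hα hβ hpos
  at_infty := tendsto_comap_iff.2 (combMap_tendsto_re_infty hpos)

/-! ### Recovering the boundary point from the end -/

theorem le_atInftyUpper_of_tendsto (h : IsEquioscillating (fun t => t ^ α * (1 - t) ^ β) n ξ M)
    (hα : 0 ≤ α) (hβ : 0 ≤ β) (hpos : 0 < α + β + n) {F : Ultrafilter ℂ} (hF : upperHalf ∈ F)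
    (hlim : Tendsto (combMap n α β ξ (-Real.log M)) F rightEnd) :
    (F : Filter ℂ) ≤ atInftyUpper := by
  have hre : Tendsto (fun z => (combMap n α β ξ (-Real.log M) z).re) F atTop :=
    tendsto_comap_iff.1 hlim
  rcases h.ultrafilter_cases hα hβ hpos F hF with
    ⟨z, -, hz⟩ | ⟨x, -, -, hx⟩ | ⟨j, -, -, -, hj⟩ | ⟨hinf, -⟩
  · exact absurd hre (not_tendsto_atTop_of_tendsto_nhds ((Complex.continuous_re.tendsto _).comp hz))
  · exact absurd hre (not_tendsto_atTop_of_tendsto_nhds ((Complex.continuous_re.tendsto _).comp hx))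
  · exact absurd hre (hj.not_tendsto disjoint_atBot_atTop)
  · exact hinf

/-- Real part tending to `-∞` forces convergence to some node, and disjointness of the half-strips
shows which one. -/
theorem le_nhds_of_tendsto_leftEnd (h : IsEquioscillating (fun t => t ^ α * (1 - t) ^ β) n ξ M)
    (hα : 0 ≤ α) (hβ : 0 ≤ β) (hpos : 0 < α + β + n) {k : ℕ} (hk : k ∈ Finset.range (n + 2))
    {F : Ultrafilter ℂ} (hF : upperHalf ∈ F)
    (hlim : Tendsto (combMap n α β ξ (-Real.log M)) F
      (leftEnd (endLower n β k) (endLower n β k + jacobiExponent n α β k))) :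
    (F : Filter ℂ) ≤ 𝓝 (ξ k : ℂ) := by
  obtain ⟨h1, h2⟩ := tendsto_inf.1 hlim
  have hre : Tendsto (fun z => (combMap n α β ξ (-Real.log M) z).re) F atBot :=
    tendsto_comap_iff.1 h1
  rcases h.ultrafilter_cases hα hβ hpos F hF with
    ⟨z, -, hz⟩ | ⟨x, -, -, hx⟩ | ⟨j, hj, hj0, hFj, -⟩ | ⟨-, hinf⟩
  · exact absurd hre (not_tendsto_atBot_of_tendsto_nhds ((Complex.continuous_re.tendsto _).comp hz))
  · exact absurd hre (not_tendsto_atBot_of_tendsto_nhds ((Complex.continuous_re.tendsto _).comp hx))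
  · have h3 := (tendsto_inf.1 ((h.tendsto_leftEnd hα hβ hpos hj hj0).mono_left hFj)).2
    obtain ⟨z, hz2, hz3⟩ := ((tendsto_principal.1 h2).and (tendsto_principal.1 h3)).exists
    rcases lt_trichotomy j k with hjk | rfl | hjk
    · have := endLower_add_le (α := α) (β := β) hjk hk
      exact absurd (hz2.2.trans_le this) (not_lt.2 hz3.1.le)
    · exact hFj.trans nhdsWithin_le_nhds
    · have := endLower_add_le (α := α) (β := β) hjk hj
      exact absurd (hz3.2.trans_le this) (not_lt.2 hz2.1.le)
  · exact absurd hre (hinf.not_tendsto disjoint_atTop_atBot)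

/-- Equal imaginary parts put every node of nonzero weight to the right of `x`; there the real part
is strictly decreasing in `x`, so the value at `0` is taken only once. -/
theorem eq_zero_of_combMap_eq (h : IsEquioscillating (fun t => t ^ α * (1 - t) ^ β) n ξ M)
    (hβ : 0 ≤ β) (hpos : 0 < α + β + n) (hα : α = 0) {x : ℝ}
    (hx : combMap n α β ξ (-Real.log M) x = (n : ℂ) * Real.pi * Complex.I) : x = 0 := by
  have hγ := fun j (_ : j ∈ Finset.range (n + 2)) =>
    jacobiExponent_nonneg (n := n) (α := α) hα.ge hβ j
  have hΓ : 0 < ∑ j ∈ Finset.range (n + 2), jacobiExponent n α β j := by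
    rwa [sum_jacobiExponent]
  rw [← h.combMap_zero hβ hα] at hx
  have him := congrArg Complex.im hx
  have hre := congrArg Complex.re hx
  rw [combMap_im_ofReal, combMap_im_of_mem_Ico h.strictMono (Nat.zero_le n)
    ⟨h.zero.le, by rw [← h.zero]; exact h.strictMono one_pos⟩] at him
  have hsum := mul_right_cancel₀ Real.pi_ne_zero him
  have hright : ∀ j ∈ Finset.range (n + 2), jacobiExponent n α β j ≠ 0 → x < ξ j := by
    have h1 := Finset.sum_filter_add_sum_filter_not (Finset.range (n + 2)) (fun j => x < ξ j)
      (jacobiExponent n α β)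
    rw [sum_jacobiExponent] at h1
    have h2 : ∑ j ∈ Finset.range (n + 2) with ¬ x < ξ j, jacobiExponent n α β j = 0 := by
      rw [Nat.cast_zero] at hsum
      linarith
    rw [Finset.sum_eq_zero_iff_of_nonneg fun j hj => hγ j (Finset.mem_of_mem_filter j hj)] at h2
    intro j hj hj0
    by_contra hc
    exact hj0 (h2 j (Finset.mem_filter.2 ⟨hj, hc⟩))
  have h0 : ∀ j ∈ Finset.range (n + 2), jacobiExponent n α β j ≠ 0 → 0 < ξ j := by
    intro j hj hj0
    have := h.regular_zero hα j hj hj0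
    refine lt_of_le_of_ne ?_ (Ne.symm this)
    rw [← h.zero]
    exact h.strictMono.monotone (Nat.zero_le j)
  rw [combMap_re_ofReal, combMap_re_ofReal] at hre
  have hre' := add_right_cancel hre
  rcases lt_trichotomy x 0 with hneg | hz | hp
  · refine absurd hre' (logSum.sum_log_lt hγ hΓ fun j hj hj0 => ?_).ne'
    have h1 := h0 j hj hj0
    rw [abs_of_neg (by linarith), abs_of_neg (by linarith)]
    constructor <;> linarith
  · exact hz
  · refine absurd hre' (logSum.sum_log_lt hγ hΓ fun j hj hj0 => ?_).ne
    have h1 := hright j hj hj0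
    rw [abs_of_neg (by linarith), abs_of_neg (by linarith)]
    constructor <;> linarith

/-- Mirror image of the case of `0`. Since the step function takes right-hand values, the imaginary
part only yields `ξ j ≤ x`, and `hreg` excludes equality. -/
theorem eq_one_of_combMap_eq (h : IsEquioscillating (fun t => t ^ α * (1 - t) ^ β) n ξ M)
    (hα : 0 ≤ α) (hpos : 0 < α + β + n) (hβ : β = 0) {x : ℝ}
    (hreg : ∀ j ∈ Finset.range (n + 2), jacobiExponent n α β j ≠ 0 → ξ j ≠ x)
    (hx : combMap n α β ξ (-Real.log M) x = 0) : x = 1 := by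
  have hγ := fun j (_ : j ∈ Finset.range (n + 2)) =>
    jacobiExponent_nonneg (n := n) (β := β) hα hβ.ge j
  have hΓ : 0 < ∑ j ∈ Finset.range (n + 2), jacobiExponent n α β j := by
    rwa [sum_jacobiExponent]
  rw [← h.combMap_one hα hβ] at hx
  have him := congrArg Complex.im hx
  have hre := congrArg Complex.re hx
  rw [combMap_im_ofReal, combMap_im_of_ge h.strictMono h.last.le] at him
  have hsum := mul_right_cancel₀ Real.pi_ne_zero him
  have h1 : ∀ j ∈ Finset.range (n + 2), jacobiExponent n α β j ≠ 0 → ξ j < 1 := by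
    intro j hj hj0
    have := h.regular_one hβ j hj hj0
    refine lt_of_le_of_ne ?_ this
    rw [← h.last]
    rw [Finset.mem_range] at hj
    exact h.strictMono.monotone (by omega)
  rw [combMap_re_ofReal, combMap_re_ofReal] at hre
  have hre' := add_right_cancel hre
  have hleft : ∀ j ∈ Finset.range (n + 2), jacobiExponent n α β j ≠ 0 → ξ j < x := by
    have h2 : ∑ j ∈ Finset.range (n + 2) with x < ξ j, jacobiExponent n α β j = 0 := by
      linarith
    rw [Finset.sum_eq_zero_iff_of_nonneg fun j hj => hγ j (Finset.mem_of_mem_filter j hj)] at h2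
    intro j hj hj0
    refine lt_of_le_of_ne ?_ (hreg j hj hj0)
    by_contra! hc
    exact hj0 (h2 j (Finset.mem_filter.2 ⟨hj, hc⟩))
  rcases lt_trichotomy x 1 with hlt | hz | hgt
  · refine absurd hre' (logSum.sum_log_lt hγ hΓ fun j hj hj0 => ?_).ne
    have h3 := hleft j hj hj0
    rw [abs_of_pos (by linarith), abs_of_pos (by linarith)]
    constructor <;> linarith
  · exact hz
  · refine absurd hre' (logSum.sum_log_lt hγ hΓ fun j hj hj0 => ?_).ne'
    have h3 := h1 j hj hj0
    rw [abs_of_pos (by linarith), abs_of_pos (by linarith)]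
    constructor <;> linarith

theorem le_nhds_of_tendsto_topEnd (h : IsEquioscillating (fun t => t ^ α * (1 - t) ^ β) n ξ M)
    (hα : 0 ≤ α) (hβ : 0 ≤ β) (hpos : 0 < α + β + n) {F : Ultrafilter ℂ} (hF : upperHalf ∈ F)
    (hlim : Tendsto (combMap n α β ξ (-Real.log M)) F (topEnd n α)) :
    (F : Filter ℂ) ≤ 𝓝 0 := by
  by_cases h0 : α = 0
  · rw [topEnd, if_pos h0] at hlim
    have hre := (Complex.continuous_re.tendsto _).comp hlim
    rcases h.ultrafilter_cases hα hβ hpos F hF with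
      ⟨z, hz, hz'⟩ | ⟨x, hFx, -, hx⟩ | ⟨j, -, -, -, hj⟩ | ⟨-, hinf⟩
    · refine absurd (h.combMap_mapsTo hα hβ hpos hz) ?_
      rw [tendsto_nhds_unique hz' hlim]
      exact natCast_mul_pi_notMem_combDomain h0
    · rw [h.eq_zero_of_combMap_eq hβ hpos h0 (tendsto_nhds_unique hx hlim), Complex.ofReal_zero]
        at hFx
      exact hFx.trans nhdsWithin_le_nhds
    · exact absurd hre (not_tendsto_nhds_of_tendsto_atBot hj _)
    · exact absurd hre (not_tendsto_nhds_of_tendsto_atTop hinf _)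
  · rw [topEnd_eq (β := β) h0] at hlim
    have := h.le_nhds_of_tendsto_leftEnd hα hβ hpos (by simp) hF hlim
    rwa [h.zero, Complex.ofReal_zero] at this

theorem le_nhds_of_tendsto_bottomEnd (h : IsEquioscillating (fun t => t ^ α * (1 - t) ^ β) n ξ M)
    (hα : 0 ≤ α) (hβ : 0 ≤ β) (hpos : 0 < α + β + n) {F : Ultrafilter ℂ} (hF : upperHalf ∈ F)
    (hlim : Tendsto (combMap n α β ξ (-Real.log M)) F (bottomEnd β)) :
    (F : Filter ℂ) ≤ 𝓝 1 := by
  by_cases h0 : β = 0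
  · rw [bottomEnd, if_pos h0] at hlim
    have hre := (Complex.continuous_re.tendsto _).comp hlim
    rcases h.ultrafilter_cases hα hβ hpos F hF with
      ⟨z, hz, hz'⟩ | ⟨x, hFx, hreg, hx⟩ | ⟨j, -, -, -, hj⟩ | ⟨-, hinf⟩
    · refine absurd (h.combMap_mapsTo hα hβ hpos hz) ?_
      rw [tendsto_nhds_unique hz' hlim]
      exact zero_notMem_combDomain h0
    · rw [h.eq_one_of_combMap_eq hα hpos h0 hreg (tendsto_nhds_unique hx hlim),
        Complex.ofReal_one] at hFx
      exact hFx.trans nhdsWithin_le_nhds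
    · exact absurd hre (not_tendsto_nhds_of_tendsto_atBot hj _)
    · exact absurd hre (not_tendsto_nhds_of_tendsto_atTop hinf _)
  · rw [bottomEnd_eq (n := n) (α := α) h0] at hlim
    have := h.le_nhds_of_tendsto_leftEnd hα hβ hpos (by simp) hF hlim
    rwa [h.last, Complex.ofReal_one] at this

theorem tendsto_midEnd_iff (h : IsEquioscillating (fun t => t ^ α * (1 - t) ^ β) n ξ M)
    (hα : 0 ≤ α) (hβ : 0 ≤ β) (hpos : 0 < α + β + n) {j : ℕ} (hj : j ∈ Finset.Icc 1 n) (x : ℝ) :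
    Tendsto (combMap n α β ξ (-Real.log M)) (𝓝[upperHalf] (x : ℂ)) (midEnd n j) ↔ x = ξ j := by
  constructor
  · intro hlim
    set F := Ultrafilter.of (𝓝[upperHalf] (x : ℂ))
    have hFx : (F : Filter ℂ) ≤ 𝓝[upperHalf] (x : ℂ) := Ultrafilter.of_le _
    rw [midEnd_eq (α := α) (β := β) hj] at hlim
    have hj' : j ∈ Finset.range (n + 2) := by
      rw [Finset.mem_Icc] at hj
      rw [Finset.mem_range]; omega
    have h1 := h.le_nhds_of_tendsto_leftEnd hα hβ hpos hj' (hFx self_mem_nhdsWithin)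
      (hlim.mono_left hFx)
    exact Complex.ofReal_injective
      (tendsto_nhds_unique (f := id) (hFx.trans nhdsWithin_le_nhds) h1)
  · rintro rfl
    exact h.tendsto_midEnd hα hβ hpos hj

end WeightedChebyshev.IsEquioscillating

/-! ### Holomorphy of the inverse of an injective map -/

section InverseFunction

variable {f : ℂ → ℂ} {U : Set ℂ}

theorem not_eventually_eq_of_injOn (hU : IsOpen U) (hinj : Set.InjOn f U) {z : ℂ} (hz : z ∈ U) :
    ¬ ∀ᶠ y in 𝓝 z, f y = f z := by
  intro hc
  have h1 : ∀ᶠ y in 𝓝[≠] z, y = z := by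
    refine Eventually.filter_mono nhdsWithin_le_nhds ?_
    filter_upwards [hc, hU.mem_nhds hz] with y hy hyU
    exact hinj hyU hz hy
  obtain ⟨y, hy, hyz⟩ := (h1.and self_mem_nhdsWithin).exists
  exact hyz hy

theorem nhds_le_map_nhds_of_injOn (hU : IsOpen U) (hf : DifferentiableOn ℂ f U)
    (hinj : Set.InjOn f U) {z : ℂ} (hz : z ∈ U) : 𝓝 (f z) ≤ map f (𝓝 z) :=
  ((hf.analyticAt (hU.mem_nhds hz)).eventually_constant_or_nhds_le_map_nhds).resolve_left
    (not_eventually_eq_of_injOn hU hinj hz)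

theorem continuousAt_invFunOn (hU : IsOpen U) (hf : DifferentiableOn ℂ f U)
    (hinj : Set.InjOn f U) {z : ℂ} (hz : z ∈ U) : ContinuousAt (Function.invFunOn f U) (f z) := by
  rw [ContinuousAt, hinj.leftInvOn_invFunOn hz]
  intro V hV
  have h1 := nhds_le_map_nhds_of_injOn hU hf hinj hz
    (image_mem_map (inter_mem hV (hU.mem_nhds hz)))
  refine mem_map.2 (mem_of_superset h1 ?_)
  rintro _ ⟨y, hy, rfl⟩
  rw [Set.mem_preimage, hinj.leftInvOn_invFunOn hy.2]
  exact hy.1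

theorem image_mem_nhds_of_injOn (hU : IsOpen U) (hf : DifferentiableOn ℂ f U)
    (hinj : Set.InjOn f U) {z : ℂ} (hz : z ∈ U) : f '' U ∈ 𝓝 (f z) :=
  nhds_le_map_nhds_of_injOn hU hf hinj hz (image_mem_map (hU.mem_nhds hz))

theorem eventually_deriv_ne_zero_of_injOn (hU : IsOpen U) (hf : DifferentiableOn ℂ f U)
    (hinj : Set.InjOn f U) {z : ℂ} (hz : z ∈ U) : ∀ᶠ y in 𝓝[≠] z, deriv f y ≠ 0 := by
  refine (hf.analyticAt (hU.mem_nhds hz)).deriv.eventually_eq_zero_or_eventually_ne_zero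
    |>.resolve_left fun hc => ?_
  obtain ⟨r, hr, hball⟩ := Metric.mem_nhds_iff.1 (inter_mem hc (hU.mem_nhds hz))
  refine not_eventually_eq_of_injOn hU hinj hz ?_
  filter_upwards [Metric.ball_mem_nhds z hr] with y hy
  exact Metric.isOpen_ball.is_const_of_deriv_eq_zero (convex_ball z r).isPreconnected
    (hf.mono fun x hx => (hball hx).2) (fun x hx => (hball hx).1) hy (Metric.mem_ball_self hr)

/-- The inverse of an injective holomorphic function is holomorphic. -/
theorem differentiableOn_invFunOn (hU : IsOpen U) (hf : DifferentiableOn ℂ f U)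
    (hinj : Set.InjOn f U) : DifferentiableOn ℂ (Function.invFunOn f U) (f '' U) := by
  rintro _ ⟨z, hz, rfl⟩
  refine DifferentiableAt.differentiableWithinAt ?_
  have hg := continuousAt_invFunOn hU hf hinj hz
  have hgz : Function.invFunOn f U (f z) = z := hinj.leftInvOn_invFunOn hz
  have hd := eventually_nhdsWithin_iff.1 (eventually_deriv_ne_zero_of_injOn hU hf hinj hz)
  rw [← hgz] at hd
  have hS := inter_mem (hg.eventually hd) (image_mem_nhds_of_injOn hU hf hinj hz)
  -- Zeros of the derivative are isolated, so the inverse is differentiable on a punctured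
  -- neighbourhood and continuous at the centre: a removable singularity.
  refine DifferentiableOn.differentiableAt
    ((Complex.differentiableOn_compl_singleton_and_continuousAt_iff hS).1 ⟨?_, hg⟩) hS
  rintro _ ⟨⟨hy, y, hyU, rfl⟩, hne⟩
  have hgy : Function.invFunOn f U (f y) = y := hinj.leftInvOn_invFunOn hyU
  rw [Set.mem_ofPred_eq, hgy, hgz] at hy
  have hdy : deriv f y ≠ 0 := hy fun hc => hne (by rw [Set.mem_singleton_iff.1 hc]; rfl)
  have hder : HasDerivAt f (deriv f y) (Function.invFunOn f U (f y)) := by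
    rw [hgy]
    exact (hf.differentiableAt (hU.mem_nhds hyU)).hasDerivAt
  refine (HasDerivAt.of_local_left_inverse (continuousAt_invFunOn hU hf hinj hyU) hder hdy
    ?_).differentiableAt.differentiableWithinAt
  filter_upwards [image_mem_nhds_of_injOn hU hf hinj hyU] with w hw
  exact Function.invFunOn_eq hw

end InverseFunction

/-! ### Schwarz–Pick and automorphisms of the half-plane -/

section SchwarzPick

open ComplexConjugate

theorem normSq_sub_conj (z a : ℂ) :
    Complex.normSq (z - conj a) = Complex.normSq (z - a) + 4 * (z.im * a.im) := by
  simp only [Complex.normSq_apply, Complex.sub_re, Complex.sub_im, Complex.conj_re,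
    Complex.conj_im]
  ring

theorem normSq_sub_conj_pos {z a : ℂ} (hz : z ∈ upperHalf) (ha : a ∈ upperHalf) :
    0 < Complex.normSq (z - conj a) := by
  have h1 : 0 < z.im * a.im := mul_pos hz ha
  rw [normSq_sub_conj]
  linarith [Complex.normSq_nonneg (z - a)]

/-- Cayley transforms centred at `a` and `f a` reduce this to the Schwarz lemma; `normSq_sub_conj`
then clears the denominators. -/
theorem schwarzPick_upperHalf {f : ℂ → ℂ} (hf : DifferentiableOn ℂ f upperHalf)
    (hmaps : Set.MapsTo f upperHalf upperHalf) {z a : ℂ} (hz : z ∈ upperHalf)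
    (ha : a ∈ upperHalf) :
    Complex.normSq (f z - f a) * (z.im * a.im) ≤
      Complex.normSq (z - a) * ((f z).im * (f a).im) := by
  -- The inverse of `z ↦ (z - a) / (z - conj a)`; it sends `0` to `a`.
  set T : ℂ → ℂ := fun u => (a - conj a * u) / (1 - u) with hT
  have hone : ∀ u ∈ Metric.ball (0 : ℂ) 1, 1 - u ≠ 0 := by
    intro u hu hc
    rw [mem_ball_zero_iff, ← sub_eq_zero.1 hc, norm_one] at hu
    exact lt_irrefl _ hu
  have hTmaps : Set.MapsTo T (Metric.ball 0 1) upperHalf := by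
    intro u hu
    have h1 := Complex.normSq_pos.2 (hone u hu)
    have h2 : Complex.normSq u < 1 := by
      rw [mem_ball_zero_iff] at hu
      rw [Complex.normSq_eq_norm_sq]
      exact pow_lt_one₀ (norm_nonneg u) hu two_ne_zero
    have h3 : (T u).im = a.im * (1 - Complex.normSq u) / Complex.normSq (1 - u) := by
      rw [hT]
      simp only [Complex.div_im, Complex.sub_re, Complex.sub_im, Complex.mul_re, Complex.mul_im,
        Complex.conj_re, Complex.conj_im, Complex.one_re, Complex.one_im]
      rw [← sub_div, Complex.normSq_apply u]
      congr 1
      ring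
    change 0 < (T u).im
    rw [h3]
    exact div_pos (mul_pos ha (sub_pos.2 h2)) h1
  set F : ℂ → ℂ := fun u => (f (T u) - f a) / (f (T u) - conj (f a)) with hF
  have hne : ∀ w ∈ upperHalf, ∀ b ∈ upperHalf, w - conj b ≠ 0 := fun w hw b hb =>
    Complex.normSq_pos.1 (normSq_sub_conj_pos hw hb)
  have hTd : DifferentiableOn ℂ T (Metric.ball 0 1) :=
    DifferentiableOn.div (by fun_prop) (by fun_prop) hone
  have hfT : DifferentiableOn ℂ (fun u => f (T u)) (Metric.ball 0 1) := hf.comp hTd hTmaps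
  have hFd : DifferentiableOn ℂ F (Metric.ball 0 1) :=
    (hfT.sub_const _).div (hfT.sub_const _) fun u hu =>
      hne _ (hmaps (hTmaps hu)) _ (hmaps ha)
  have hFmaps : Set.MapsTo F (Metric.ball 0 1) (Metric.closedBall 0 1) := by
    intro u hu
    have h1 := normSq_sub_conj_pos (hmaps (hTmaps hu)) (hmaps ha)
    have h2 : 0 < (f (T u)).im * (f a).im := mul_pos (hmaps (hTmaps hu)) (hmaps ha)
    rw [mem_closedBall_zero_iff, ← sq_le_one_iff₀ (norm_nonneg _), ← Complex.normSq_eq_norm_sq,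
      Complex.normSq_div, div_le_one h1, normSq_sub_conj]
    linarith
  have hF0 : F 0 = 0 := by simp [hF, hT]
  set u := (z - a) / (z - conj a) with hu
  have hzc := hne z hz a ha
  have hTu : T u = z := by
    have hac : a - conj a ≠ 0 := hne a ha a ha
    have h1 : 1 - u = (a - conj a) / (z - conj a) := by
      rw [hu]; field_simp; ring
    rw [hT]
    simp only
    rw [h1, div_eq_iff (div_ne_zero hac hzc), hu]
    field_simp
    ring
  have hP : 0 < (f z).im * (f a).im := mul_pos (hmaps hz) (hmaps ha)
  have hQ : 0 < z.im * a.im := mul_pos hz ha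
  have hnu : Complex.normSq u = Complex.normSq (z - a) / Complex.normSq (z - conj a) :=
    Complex.normSq_div _ _
  have hu1 : ‖u‖ < 1 := by
    rw [← sq_lt_one_iff₀ (norm_nonneg _), ← Complex.normSq_eq_norm_sq, hnu,
      div_lt_one (normSq_sub_conj_pos hz ha), normSq_sub_conj]
    linarith
  have hS := Complex.norm_le_norm_of_mapsTo_ball hFd hFmaps hF0 hu1
  have hS2 := pow_le_pow_left₀ (norm_nonneg _) hS 2
  rw [← Complex.normSq_eq_norm_sq, ← Complex.normSq_eq_norm_sq, hnu, hF] at hS2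
  simp only at hS2
  rw [hTu, Complex.normSq_div, div_le_div_iff₀ (normSq_sub_conj_pos (hmaps hz) (hmaps ha))
    (normSq_sub_conj_pos hz ha), normSq_sub_conj, normSq_sub_conj] at hS2
  linarith

/-- A holomorphic automorphism of the upper half-plane that fixes the boundary points `0`, `1` and
`∞` is the identity. -/
theorem eqOn_id_of_automorphism_upperHalf {φ ψ : ℂ → ℂ} (hφ : DifferentiableOn ℂ φ upperHalf)
    (hψ : DifferentiableOn ℂ ψ upperHalf) (hφm : Set.MapsTo φ upperHalf upperHalf)
    (hψm : Set.MapsTo ψ upperHalf upperHalf) (hinv : Set.LeftInvOn ψ φ upperHalf)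
    (h0 : Tendsto φ (𝓝[upperHalf] 0) (𝓝 0)) (h1 : Tendsto φ (𝓝[upperHalf] 1) (𝓝 1))
    (hinf : Tendsto φ atInftyUpper (Bornology.cobounded ℂ)) :
    Set.EqOn φ id upperHalf := by
  -- Schwarz–Pick for both `φ` and its left inverse forces equality.
  have key : ∀ z ∈ upperHalf, ∀ a ∈ upperHalf, Complex.normSq (φ z - φ a) * (z.im * a.im) =
      Complex.normSq (z - a) * ((φ z).im * (φ a).im) := by
    intro z hz a ha
    refine le_antisymm (schwarzPick_upperHalf hφ hφm hz ha) ?_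
    have := schwarzPick_upperHalf hψ hψm (hφm hz) (hφm ha)
    rwa [hinv hz, hinv ha] at this
  -- Comparing two base points eliminates `z.im` and `(φ z).im`, so the identity survives as `z`
  -- tends to the boundary.
  have ratio : ∀ z ∈ upperHalf, ∀ a ∈ upperHalf, ∀ b ∈ upperHalf,
      Complex.normSq (φ z - φ a) * Complex.normSq (z - b) * (a.im * (φ b).im) =
        Complex.normSq (φ z - φ b) * Complex.normSq (z - a) * (b.im * (φ a).im) := by
    intro z hz a ha b hb
    have ea := key z hz a ha
    have eb := key z hz b hb
    refine mul_left_cancel₀ (ne_of_gt hz : z.im ≠ 0) ?_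
    linear_combination Complex.normSq (z - b) * (φ b).im * ea
      - Complex.normSq (z - a) * (φ a).im * eb
  have hN : Continuous Complex.normSq := Complex.continuous_normSq
  have lim : ∀ x : ℝ, Tendsto φ (𝓝[upperHalf] (x : ℂ)) (𝓝 (x : ℂ)) →
      ∀ a ∈ upperHalf, ∀ b ∈ upperHalf,
      Complex.normSq (x - φ a) * Complex.normSq (x - b) * (a.im * (φ b).im) =
        Complex.normSq (x - φ b) * Complex.normSq (x - a) * (b.im * (φ a).im) := by
    intro x hx a ha b hb
    have hid : Tendsto (fun z : ℂ => z) (𝓝[upperHalf] (x : ℂ)) (𝓝 (x : ℂ)) :=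
      tendsto_id.mono_left nhdsWithin_le_nhds
    have hNc : ∀ {g : ℂ → ℂ} (c : ℂ), Tendsto g (𝓝[upperHalf] (x : ℂ)) (𝓝 (x : ℂ)) →
        Tendsto (fun z => Complex.normSq (g z - c)) (𝓝[upperHalf] (x : ℂ))
          (𝓝 (Complex.normSq (x - c))) :=
      fun c hg => (hN.tendsto _).comp (hg.sub_const c)
    refine tendsto_nhds_unique_of_eventuallyEq (((hNc _ hx).mul (hNc _ hid)).mul_const _)
      (((hNc _ hx).mul (hNc _ hid)).mul_const _) ?_
    filter_upwards [self_mem_nhdsWithin] with z hz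
    exact ratio z hz a ha b hb
  have hup : ∀ᶠ z in atInftyUpper, z ∈ upperHalf :=
    Eventually.filter_mono inf_le_right (mem_principal_self _)
  -- As `z → ∞` the quotients of squared distances tend to `1`, leaving only the imaginary parts.
  have him : ∀ a ∈ upperHalf, ∀ b ∈ upperHalf, a.im * (φ b).im = b.im * (φ a).im := by
    intro a ha b hb
    have hid : Tendsto (fun z : ℂ => z) atInftyUpper (Bornology.cobounded ℂ) :=
      tendsto_id.mono_left inf_le_left
    have hquot : ∀ {g : ℂ → ℂ} (c d : ℂ), Tendsto g atInftyUpper (Bornology.cobounded ℂ) →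
        Tendsto (fun z => Complex.normSq ((g z - c) / (g z - d))) atInftyUpper (𝓝 1) := by
      intro g c d hg
      have h2 : Tendsto (fun z => g z - d) atInftyUpper (Bornology.cobounded ℂ) := by
        rw [← tendsto_norm_atTop_iff_cobounded] at hg ⊢
        exact tendsto_atTop_mono (fun z => norm_sub_norm_le (g z) d)
          (tendsto_atTop_add_const_right _ (-‖d‖) hg)
      have h3 : Tendsto (fun z => 1 + (d - c) * (g z - d)⁻¹) atInftyUpper (𝓝 1) := by
        simpa using ((tendsto_inv₀_cobounded.comp h2).const_mul (d - c)).const_add 1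
      have h4 := (hN.tendsto _).comp h3
      rw [map_one] at h4
      refine h4.congr' ?_
      filter_upwards [h2.eventually (Bornology.eventually_ne_cobounded 0)] with z hz
      simp only [Function.comp_apply]
      congr 1
      field_simp
      ring
    have hl := (hquot (φ a) (φ b) hinf).mul_const (a.im * (φ b).im)
    have hr := (hquot a b hid).mul_const (b.im * (φ a).im)
    rw [one_mul] at hl hr
    refine tendsto_nhds_unique_of_eventuallyEq hl hr ?_
    filter_upwards [hup, hinf.eventually (Bornology.eventually_ne_cobounded (φ b)),
      hid.eventually (Bornology.eventually_ne_cobounded b)] with z hz hz1 hz2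
    have e1 := Complex.normSq_pos.2 (sub_ne_zero.2 hz1)
    have e2 := Complex.normSq_pos.2 (sub_ne_zero.2 hz2)
    have e3 := ratio z hz a ha b hb
    rw [Complex.normSq_div, Complex.normSq_div]
    field_simp
    linarith
  have lim' : ∀ x : ℝ, Tendsto φ (𝓝[upperHalf] (x : ℂ)) (𝓝 (x : ℂ)) →
      ∀ a ∈ upperHalf, ∀ b ∈ upperHalf,
      Complex.normSq (x - φ a) * Complex.normSq (x - b) =
        Complex.normSq (x - φ b) * Complex.normSq (x - a) := by
    intro x hx a ha b hb
    have h2 := lim x hx a ha b hb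
    rw [him a ha b hb] at h2
    exact mul_right_cancel₀ (mul_pos hb (hφm ha)).ne' h2
  -- Letting `b` tend to the second fixed point `y` shows that `φ` preserves the distance to `x`.
  -- Distances to `0` and `1` determine a point of the upper half-plane.
  have fin : ∀ x y : ℝ, x ≠ y → Tendsto φ (𝓝[upperHalf] (x : ℂ)) (𝓝 (x : ℂ)) →
      Tendsto φ (𝓝[upperHalf] (y : ℂ)) (𝓝 (y : ℂ)) → ∀ a ∈ upperHalf,
      Complex.normSq (x - φ a) = Complex.normSq (x - a) := by
    intro x y hxy hx hy a ha
    have hid : Tendsto (fun z : ℂ => z) (𝓝[upperHalf] (y : ℂ)) (𝓝 (y : ℂ)) :=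
      tendsto_id.mono_left nhdsWithin_le_nhds
    have hl := ((hN.tendsto _).comp (hid.const_sub (x : ℂ))).const_mul (Complex.normSq (x - φ a))
    have hr := ((hN.tendsto _).comp (hy.const_sub (x : ℂ))).mul_const (Complex.normSq (x - a))
    have h2 := tendsto_nhds_unique_of_eventuallyEq hl hr (by
      filter_upwards [self_mem_nhdsWithin] with z hz
      exact lim' x hx a ha z hz)
    rw [mul_comm] at h2
    refine mul_left_cancel₀ (Complex.normSq_pos.2 ?_).ne' h2
    rw [← Complex.ofReal_sub]
    exact_mod_cast sub_ne_zero.2 hxy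
  intro a ha
  have h0' : Tendsto φ (𝓝[upperHalf] ((0 : ℝ) : ℂ)) (𝓝 ((0 : ℝ) : ℂ)) := by simpa using h0
  have h1' : Tendsto φ (𝓝[upperHalf] ((1 : ℝ) : ℂ)) (𝓝 ((1 : ℝ) : ℂ)) := by simpa using h1
  have e0 := fin 0 1 zero_ne_one h0' h1' a ha
  have e1 := fin 1 0 one_ne_zero h1' h0' a ha
  simp only [Complex.normSq_apply, Complex.sub_re, Complex.sub_im, Complex.ofReal_re,
    Complex.ofReal_im] at e0 e1
  have hre : (φ a).re = a.re := by linarith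
  refine Complex.ext hre ?_
  rw [hre] at e0
  have h2 : 0 < (φ a).im := hφm ha
  have h3 : 0 < a.im := ha
  simp only [id]
  nlinarith

end SchwarzPick

/-! ### Uniqueness and conclusion -/

theorem tendsto_of_forall_ultrafilter {X Y : Type*} {w : X → Y} {s : Set X} {φ : X → X}
    {l m : Filter X} {e : Filter Y} (hφ : φ ⁻¹' s ∈ l) (hw : Tendsto (w ∘ φ) l e)
    (h : ∀ F : Ultrafilter X, s ∈ F → Tendsto w F e → (F : Filter X) ≤ m) : Tendsto φ l m := by
  refine (tendsto_iff_ultrafilter φ l m).2 fun G hG => ?_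
  refine h (G.map φ) (hG hφ) ?_
  rw [Ultrafilter.coe_map, tendsto_map'_iff]
  exact hw.mono_left hG

namespace WeightedChebyshev.IsEquioscillating

variable {n : ℕ} {α β M : ℝ} {ξ : ℕ → ℝ}

/-- The automorphism `φ = w₀⁻¹ ∘ w` fixes `0`, `1`, `∞` because `w₀` approaches each of the three
ends only at the corresponding boundary point. No boundary regularity of `w` beyond the
normalisation enters. -/
theorem eqOn_combMap (h : IsEquioscillating (fun t => t ^ α * (1 - t) ^ β) n ξ M)
    (hα : 0 ≤ α) (hβ : 0 ≤ β) (hpos : 0 < α + β + n) {w : ℂ → ℂ} (hw : IsCombMap n α β w) :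
    Set.EqOn w (combMap n α β ξ (-Real.log M)) upperHalf := by
  set w₀ := combMap n α β ξ (-Real.log M) with hw₀
  have h₀ : IsCombMap n α β w₀ := h.isCombMap hα hβ hpos
  have inv : ∀ {v : ℂ → ℂ}, IsCombMap n α β v →
      DifferentiableOn ℂ (Function.invFunOn v upperHalf) (combDomain n α β) ∧
      Set.MapsTo (Function.invFunOn v upperHalf) (combDomain n α β) upperHalf ∧
      Set.RightInvOn (Function.invFunOn v upperHalf) v (combDomain n α β) := by
    intro v hv
    have h1 := differentiableOn_invFunOn isOpen_upperHalf hv.differentiableOn hv.bijOn.injOn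
    rw [hv.bijOn.image_eq] at h1
    exact ⟨h1, hv.bijOn.surjOn.mapsTo_invFunOn, hv.bijOn.surjOn.rightInvOn_invFunOn⟩
  obtain ⟨hd₀, hm₀, hr₀⟩ := inv h₀
  obtain ⟨hd, hm, -⟩ := inv hw
  set φ : ℂ → ℂ := Function.invFunOn w₀ upperHalf ∘ w with hφ
  set ψ : ℂ → ℂ := Function.invFunOn w upperHalf ∘ w₀ with hψ
  have hwφ : ∀ z ∈ upperHalf, w₀ (φ z) = w z := fun z hz => hr₀ (hw.bijOn.mapsTo hz)
  have hφm : Set.MapsTo φ upperHalf upperHalf := hm₀.comp hw.bijOn.mapsTo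
  have hψφ : Set.LeftInvOn ψ φ upperHalf := by
    intro z hz
    rw [hψ, Function.comp_apply, hwφ z hz]
    exact hw.bijOn.injOn.leftInvOn_invFunOn hz
  have hlim : ∀ {l m e : Filter ℂ}, upperHalf ∈ l → Tendsto w l e →
      (∀ F : Ultrafilter ℂ, upperHalf ∈ F → Tendsto w₀ F e → (F : Filter ℂ) ≤ m) →
      Tendsto φ l m := by
    intro l m e hl hwe hF
    refine tendsto_of_forall_ultrafilter (s := upperHalf) (mem_of_superset hl hφm) (hwe.congr' ?_) hF
    filter_upwards [hl] with z hz
    exact (hwφ z hz).symm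
  have hid := eqOn_id_of_automorphism_upperHalf (hd₀.comp hw.differentiableOn hw.bijOn.mapsTo)
    (hd.comp h₀.differentiableOn h₀.bijOn.mapsTo) hφm (hm.comp h₀.bijOn.mapsTo) hψφ
    (hlim self_mem_nhdsWithin hw.at_zero fun _ hF => h.le_nhds_of_tendsto_topEnd hα hβ hpos hF)
    (hlim self_mem_nhdsWithin hw.at_one fun _ hF => h.le_nhds_of_tendsto_bottomEnd hα hβ hpos hF)
    (hlim (mem_inf_of_right (mem_principal_self _)) hw.at_infty fun _ hF hF' =>
      (h.le_atInftyUpper_of_tendsto hα hβ hpos hF hF').trans inf_le_left)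
  intro z hz
  rw [← hwφ z hz]
  exact congrArg w₀ (hid hz)

end WeightedChebyshev.IsEquioscillating

theorem combMap_isBigO {n : ℕ} {α β C : ℝ} {ξ : ℕ → ℝ} :
    (fun z : ℂ => combMap n α β ξ C z -
      (((α + β + n : ℝ) : ℂ) * Complex.log z + C - β * Real.pi * Complex.I))
      =O[atInftyUpper] fun z : ℂ => z⁻¹ := by
  have h := logSum.sub_log_isBigO (s := Finset.range (n + 2)) (γ := jacobiExponent n α β) (ξ := ξ)
  rw [sum_jacobiExponent] at h
  refine h.congr_left fun z => ?_
  rw [combMap]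
  ring

theorem proposition2 (n : ℕ) (α β : ℝ) (hα : 0 ≤ α) (hβ : 0 ≤ β) (hpos : 0 < α + β + n) :
    -- the normalized conformal mapping exists and is unique
    (∃ w : ℂ → ℂ, IsCombMap n α β w) ∧
    (∀ w w' : ℂ → ℂ, IsCombMap n α β w → IsCombMap n α β w' → Set.EqOn w w' upperHalf) ∧
    ∀ w : ℂ → ℂ, IsCombMap n α β w →
      ∃ (C : ℝ) (ξ : ℕ → ℝ),
        -- `C` is the constant in the asymptotics of `w` at infinity
        ((fun z : ℂ => w z - (((α + β + n : ℝ) : ℂ) * Complex.log z + C - β * Real.pi * Complex.I))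
          =O[atInftyUpper] fun z : ℂ => z⁻¹) ∧
        -- `ξ j` is the preimage of `∞_j`
        (∀ j ∈ Finset.Icc 1 n, ∀ x : ℝ,
          Tendsto w (𝓝[upperHalf] (x : ℂ)) (midEnd n j) ↔ x = ξ j) ∧
        -- the formula for `e ^ w` in the upper half-plane (principal branches)
        (∀ z ∈ upperHalf, Complex.exp (w z) =
          z ^ (α : ℂ) * (1 - z) ^ (β : ℂ) * Real.exp C * ∏ j ∈ Finset.Icc 1 n, (z - ξ j)) ∧
        -- the formula for the boundary values of `e ^ w` on `[0, 1]`
        (∀ t ∈ Set.Icc (0 : ℝ) 1,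
          Tendsto (fun z => Complex.exp (w z)) (𝓝[upperHalf] (t : ℂ))
            (𝓝 ((t ^ α * (1 - t) ^ β * Real.exp C * ∏ j ∈ Finset.Icc 1 n, (t - ξ j) : ℝ) : ℂ))) ∧
        -- `w` itself has finite boundary values on `[0, 1]` where the right-hand side is nonzero
        (∀ t ∈ Set.Icc (0 : ℝ) 1,
          t ^ α * (1 - t) ^ β * Real.exp C * ∏ j ∈ Finset.Icc 1 n, (t - ξ j) ≠ 0 →
            ∃ wt : ℂ, Tendsto w (𝓝[upperHalf] (t : ℂ)) (𝓝 wt) ∧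
              Complex.exp wt =
                ((t ^ α * (1 - t) ^ β * Real.exp C * ∏ j ∈ Finset.Icc 1 n, (t - ξ j) : ℝ) : ℂ)) ∧
        -- `(t - ξ_1) ⋯ (t - ξ_n)` is the polynomial of least deviation from zero
        (∀ p : Polynomial ℂ, IsLeastDeviation n α β p ↔ p = monicJacobi n ξ) ∧
        -- its weighted norm
        jacobiNorm α β (monicJacobi n ξ) = Real.exp (-C) ∧
        -- the formula for `e ^ w` through the normalized polynomial
        (∀ t ∈ Set.Icc (0 : ℝ) 1,
          Tendsto (fun z => Complex.exp (w z)) (𝓝[upperHalf] (t : ℂ))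
            (𝓝 (((t ^ α * (1 - t) ^ β : ℝ) : ℂ) * ((monicJacobi n ξ).eval (t : ℂ) /
              (jacobiNorm α β (monicJacobi n ξ) : ℂ))))) := by
  obtain ⟨ξ, M, h⟩ := WeightedChebyshev.exists_isEquioscillating (jacobiWeight_continuous hα hβ)
    (jacobiWeight_pos α β) (jacobiWeight_nonneg α β) n
  refine ⟨⟨_, h.isCombMap hα hβ hpos⟩, fun w w' hw hw' => ?_, fun w hw => ?_⟩
  · exact (h.eqOn_combMap hα hβ hpos hw).trans (h.eqOn_combMap hα hβ hpos hw').symm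
  have heq := h.eqOn_combMap hα hβ hpos hw
  have hev : ∀ x : ℂ, combMap n α β ξ (-Real.log M) =ᶠ[𝓝[upperHalf] x] w := fun x =>
    heq.symm.eventuallyEq_nhdsWithin
  have hexp : ∀ t ∈ Set.Icc (0 : ℝ) 1, Tendsto (fun z => Complex.exp (w z))
      (𝓝[upperHalf] (t : ℂ)) (𝓝 (jacobiFun n α β ξ (-Real.log M) t : ℂ)) := fun t ht =>
    (tendsto_exp_combMap hα hβ h.zero h.last ht).congr' ((hev t).fun_comp Complex.exp)
  refine ⟨-Real.log M, ξ, ?_, fun j hj x => ?_, fun z hz => ?_, hexp, fun t ht hne => ?_,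
    h.isLeastDeviation_iff hα hβ, ?_, fun t ht => ?_⟩
  · refine (combMap_isBigO (n := n) (α := α) (β := β) (ξ := ξ) (C := -Real.log M)).congr' ?_ EventuallyEq.rfl
    filter_upwards [mem_inf_of_right (mem_principal_self upperHalf)] with z hz
    rw [heq hz]
  · rw [← h.tendsto_midEnd_iff hα hβ hpos hj x]
    exact tendsto_congr' (hev x).symm
  · rw [heq hz, exp_combMap h.zero h.last hz]
  · exact ⟨_, (tendsto_combMap ((regular_iff_jacobiFun_ne_zero h.zero h.last ht).2 hne)).congr'
      (hev t), exp_combMap_ofReal hα hβ h.zero h.last ht hne⟩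
  · rw [h.jacobiNorm_eq hα hβ, neg_neg, Real.exp_log h.pos]
  · refine (congrArg (fun y => Tendsto (fun z => Complex.exp (w z)) (𝓝[upperHalf] (t : ℂ)) (𝓝 y))
      ?_).mp (hexp t ht)
    rw [h.jacobiNorm_eq hα hβ, monicJacobi_eval, jacobiFun, Real.exp_neg, Real.exp_log h.pos]
    push_cast
    ring
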